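/- Let $N\ge 2$ and $\lambda\in\mathbb{R}$, and let $\Omega_0\subset\mathbb{R}^N$ be a compact set with boundary $\partial\Omega_0$ of class $C^5$; that is, near each $x\in\partial\Omega_0$ the set $\Omega_0$ is, in Cartesian coordinates centered at $x$ whose last axis is the outward unit normal, the region on and below the graph of a $C^5$ function $f$ with $f(0)=0$ and $\nabla f(0)=0$. For $t>0$ let $$G_{N,\lambda}(x,t)=\frac1{(2\pi)^{N}}\int_{\mathbb{R}^N}e^{-(|\xi|^4+\lambda|\xi|^2)t+\mathbf{i}\langle x,\xi\rangle}\,d\xi ,\qquad u(x,t)=\int_{\Omega_0}G_{N,\lambda}(x-y,t)\,dy,$$ so that $u$ is the solution $G_{N,\lambda}(\cdot,t)*\chi_{\Omega_0}$ of $u_t=-\Delta^2u+\lambda\Delta u$ in $\mathbb{R}^N\times(0,\infty)$ with initial value the indicator function $\chi_{\Omega_0}$. Let $a>0$ be the number with $18a^4/11=1$, put $u_b(x,t)=u(x,b^4t)$ for $b>0$, and set $$U(x,t)=u_{3a}(x,t)-3u_{2a}(x,t)+3u_a(x,t),\qquad \Omega(t)=\Bigl\{x\in\mathbb{R}^N\;\Big|\;U(x,t)\ge\tfrac12\Bigr\}.$$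 Let $d(\cdot,\partial\Omega_0)$ be the signed distance to $\partial\Omega_0$, equal to $\inf_{x\in\partial\Omega_0}|y-x|$ for $y\in\Omega_0$ and to $-\inf_{x\in\partial\Omega_0}|y-x|$ for $y\in\mathbb{R}^N\setminus\Omega_0$. Then for every $\varepsilon\in(0,1)$ there exists $t_{*,\varepsilon}>0$ such that $$\partial\Omega(t)\subset\bigl\{x\in\mathbb{R}^N\;\big|\;|d(x,\partial\Omega_0)|\le\varepsilon t^{1/4}\bigr\}\qquad\text{for all } t\in(0,t_{*,\varepsilon}).$$ -/

import Mathlib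

open MeasureTheory

open scoped RealInnerProductSpace

namespace Thresholding

/-- `Ω` has boundary of class `C^k`: near each boundary point `x`, with outward unit normal `n`,
the set `Ω` is the region below the graph, over the tangent hyperplane `n^⊥`, of a `C^k` function
`f` with `f 0 = 0` and `∇ f 0 = 0`; heights are measured along `n`, with `x` as origin. -/
def HasBoundaryOfClass {N : ℕ} (k : ℕ) (Ω : Set (EuclideanSpace ℝ (Fin N))) : Prop :=
  ∀ x ∈ frontier Ω, ∃ n : EuclideanSpace ℝ (Fin N), ‖n‖ = 1 ∧
    ∃ f : (ℝ ∙ n)ᗮ → ℝ, ContDiff ℝ (k : ℕ∞) f ∧ f 0 = 0 ∧ fderiv ℝ f 0 = 0 ∧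
      ∃ r > 0, ∀ y ∈ Metric.ball x r,
        (y ∈ Ω ↔ ⟪n, y - x⟫ ≤ f ((ℝ ∙ n)ᗮ.orthogonalProjectionOnto (y - x)))

/-- The fundamental solution of `∂_t + (-Δ)^2 + lam (-Δ)` on `ℝ^N × (0, ∞)`,
`G(x,t) = (2π)^{-N} ∫ exp (-(|ξ|^4 + lam |ξ|^2) t + i ⟨x, ξ⟩) dξ`.
The integral is a real number, as the integrand is conjugated by `ξ ↦ -ξ`. -/
noncomputable def fundamentalSolution (N : ℕ) (lam : ℝ) (x : EuclideanSpace ℝ (Fin N)) (t : ℝ) :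
    ℝ :=
  ((2 * Real.pi) ^ N)⁻¹ *
    (∫ ξ : EuclideanSpace ℝ (Fin N),
      Complex.exp (((-((‖ξ‖ ^ 4 + lam * ‖ξ‖ ^ 2) * t) : ℝ) : ℂ) +
        Complex.I * ((⟪x, ξ⟫ : ℝ) : ℂ))).re

/-- For `t > 0`, the solution `u(·,t) = G(·,t) ∗ χ_Ω₀` of `u_t = -Δ²u + lam Δu` with initial value
the indicator function of `Ω₀`. -/
noncomputable def solution {N : ℕ} (lam : ℝ) (Ω₀ : Set (EuclideanSpace ℝ (Fin N)))
    (x : EuclideanSpace ℝ (Fin N)) (t : ℝ) : ℝ :=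
  ∫ y : EuclideanSpace ℝ (Fin N),
    fundamentalSolution N lam (x - y) t * Ω₀.indicator (fun _ => (1 : ℝ)) y

/-- `u_a(x,t) = u(x, a^4 t)`. -/
noncomputable def scaledSolution {N : ℕ} (lam : ℝ) (Ω₀ : Set (EuclideanSpace ℝ (Fin N))) (a : ℝ)
    (x : EuclideanSpace ℝ (Fin N)) (t : ℝ) : ℝ :=
  solution lam Ω₀ x (a ^ 4 * t)

/-- The threshold function `U = u_{3a} - 3 u_{2a} + 3 u_a`. -/
noncomputable def thresholdFunction {N : ℕ} (lam : ℝ) (Ω₀ : Set (EuclideanSpace ℝ (Fin N)))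
    (a : ℝ) (x : EuclideanSpace ℝ (Fin N)) (t : ℝ) : ℝ :=
  scaledSolution lam Ω₀ (3 * a) x t - 3 * scaledSolution lam Ω₀ (2 * a) x t +
    3 * scaledSolution lam Ω₀ a x t

/-- The new set `Ω(t) = {x | U(x,t) ≥ 1/2}`. -/
def evolvedSet {N : ℕ} (lam : ℝ) (Ω₀ : Set (EuclideanSpace ℝ (Fin N))) (a t : ℝ) :
    Set (EuclideanSpace ℝ (Fin N)) :=
  {x | 1 / 2 ≤ thresholdFunction lam Ω₀ a x t}

open Classical in
/-- The signed distance to `∂Ω₀`, nonnegative on `Ω₀` and nonpositive outside. -/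
noncomputable def signedDistance {N : ℕ} (Ω₀ : Set (EuclideanSpace ℝ (Fin N)))
    (y : EuclideanSpace ℝ (Fin N)) : ℝ :=
  if y ∈ Ω₀ then Metric.infDist y (frontier Ω₀) else -Metric.infDist y (frontier Ω₀)

end Thresholding

/-!
The claim is a soft statement about blow-up limits combined with one sign computation.

Write `τ = t^{1/4}`. By parabolic scaling `u_b(x, t) = ∫ k_B(z) χ(x - b τ z) dz`, where
`χ` is the indicator of `Ω₀`, `k_B` is the kernel with Fourier symbol `exp (-(|ξ|⁴ + B |ξ|²))` and
`B = λ b² τ² → 0`. If the claim fails, there are `t_k → 0` and points `x_k` of the boundary of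
`Ω(t_k)`, where `U = 1/2` by continuity, at distance more than `ε τ_k` from `∂Ω₀`. Along a
subsequence the sets `(x_k - Ω₀) / τ_k` converge to the whole space, to the empty set, or to a
half-space `{c ≤ ⟨n, y⟩}` with `c ≠ 0` (`exists_blowsUp`): the `x_k` that approach `∂Ω₀`
accumulate at a point of it by compactness, the graph function `f` in a chart there is strictly
differentiable with zero derivative at the origin, so the graph flattens at the scale `τ_k`, and the
height of `x_k` over the graph is at least `ε τ_k` in absolute value.

The kernels `k_B` decay faster than any power, uniformly for `|B| ≤ 1`
(`exists_norm_fourier_quarticSymbol_le`), because the derivatives of their symbols do. Dominated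
convergence then gives limits of `U(x_k, t_k)`: the value is `1`, `0`, or `1/2 - H(c / a)`, where
`H(s) = F(s/3) - 3 F(s/2) + 3 F(s)` and `F(s) = ∫₀ˢ g` for the one-dimensional kernel `g`, which is
the marginal of `k_0` in every direction (`setIntegral_quarticKernel_preimage`, by uniqueness of
characteristic functions). The contradiction comes from `H(s) ≠ 0` for `s ≠ 0`.

The kernel `g` oscillates, so this needs an argument. Integration by parts shows that `F(s)` is an
average of the values `Si(s ξ)` of the sine integral against a positive weight on `ξ > 0`
(`lineProfile_eq_integral_sineIntegral`). Hence `H > 0` on `(0, ∞)` follows from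
`Si(z/3) - 3 Si(z/2) + 3 Si(z) > 0` for `z > 0` (`sineIntegralCombination_pos`), which is
elementary.
-/

namespace Thresholding

open scoped FourierTransform ContDiff
open Filter Topology

/-! ### The sine integral -/

/-- The sine integral `Si z = ∫₀^z sin x / x dx`. -/
noncomputable def sineIntegral (z : ℝ) : ℝ := ∫ x in (0 : ℝ)..z, Real.sinc x

lemma hasDerivAt_sineIntegral (z : ℝ) : HasDerivAt sineIntegral (Real.sinc z) z :=
  intervalIntegral.integral_hasDerivAt_right (Real.continuous_sinc.intervalIntegrable _ _)
    (Real.continuous_sinc.stronglyMeasurableAtFilter _ _) Real.continuous_sinc.continuousAt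

lemma hasDerivAt_sineIntegral_of_pos {z : ℝ} (hz : 0 < z) :
    HasDerivAt sineIntegral (Real.sin z / z) z := by
  simpa [Real.sinc_of_ne_zero hz.ne'] using hasDerivAt_sineIntegral z

lemma continuous_sineIntegral : Continuous sineIntegral :=
  continuous_iff_continuousAt.2 fun z => (hasDerivAt_sineIntegral z).continuousAt

@[simp] lemma sineIntegral_zero : sineIntegral 0 = 0 := by simp [sineIntegral]

lemma sineIntegral_neg (z : ℝ) : sineIntegral (-z) = -sineIntegral z := by
  have h := intervalIntegral.integral_comp_neg (a := 0) (b := z) Real.sinc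
  simp only [Real.sinc_neg, neg_zero] at h
  rw [sineIntegral, sineIntegral, h, intervalIntegral.integral_symm]

lemma abs_sineIntegral_le (z : ℝ) : |sineIntegral z| ≤ |z| := by
  have := intervalIntegral.norm_integral_le_of_norm_le_const (a := 0) (b := z) (f := Real.sinc)
    (C := 1) fun x _ => by simpa using Real.abs_sinc_le_one x
  simpa [sineIntegral] using this

lemma monotoneOn_of_hasDerivAt_nonneg {f f' : ℝ → ℝ} {D : Set ℝ} (hD : Convex ℝ D)
    (hf : ∀ x ∈ D, HasDerivAt f (f' x) x) (h : ∀ x ∈ D, 0 ≤ f' x) : MonotoneOn f D := by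
  refine monotoneOn_of_deriv_nonneg hD (fun x hx => (hf x hx).continuousAt.continuousWithinAt)
    (fun x hx => (hf x (interior_subset hx)).differentiableAt.differentiableWithinAt) ?_
  intro x hx
  rw [(hf x (interior_subset hx)).deriv]
  exact h x (interior_subset hx)

lemma sineIntegral_monotoneOn : MonotoneOn sineIntegral (Set.Icc 0 Real.pi) := by
  refine monotoneOn_of_hasDerivAt_nonneg (convex_Icc _ _)
    (fun x _ => hasDerivAt_sineIntegral x) fun x hx => ?_
  rcases hx.1.eq_or_lt with rfl | h0
  · simp
  · rw [Real.sinc_of_ne_zero h0.ne']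
    exact div_nonneg (Real.sin_nonneg_of_nonneg_of_le_pi hx.1 hx.2) hx.1

lemma sin_nonpos_of_mem_Icc_pi_two_pi {x : ℝ} (hx : x ∈ Set.Icc Real.pi (2 * Real.pi)) :
    Real.sin x ≤ 0 := by
  have h := Real.sin_nonneg_of_nonneg_of_le_pi (x := x - Real.pi) (by linarith [hx.1])
    (by linarith [hx.2])
  rw [Real.sin_sub_pi] at h
  linarith

lemma sineIntegral_antitoneOn : AntitoneOn sineIntegral (Set.Icc Real.pi (2 * Real.pi)) := by
  have : MonotoneOn (fun x => -sineIntegral x) (Set.Icc Real.pi (2 * Real.pi)) := by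
    refine monotoneOn_of_hasDerivAt_nonneg (convex_Icc _ _)
      (fun x _ => (hasDerivAt_sineIntegral x).neg) fun x hx => ?_
    have hp : 0 < x := Real.pi_pos.trans_le hx.1
    rw [Real.sinc_of_ne_zero hp.ne', ← neg_div]
    exact div_nonneg (by linarith [sin_nonpos_of_mem_Icc_pi_two_pi hx]) hp.le
  intro x hx y hy hxy
  have := this hx hy hxy
  simpa using this

/-- Integration by parts with the primitive `-(1 + cos)` of `sin`, which vanishes at `π`. -/
lemma sineIntegral_le_sineIntegral_pi {z : ℝ} (hz : 0 ≤ z) :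
    sineIntegral z ≤ sineIntegral Real.pi := by
  have hpi := Real.pi_pos
  rcases le_total z Real.pi with h | h
  · exact sineIntegral_monotoneOn ⟨hz, h⟩ ⟨hpi.le, le_rfl⟩ h
  have hm : MonotoneOn (fun x => -(sineIntegral x + (1 + Real.cos x) / x))
      (Set.Ici Real.pi) := by
    refine monotoneOn_of_hasDerivAt_nonneg (convex_Ici _)
      (f' := fun x => (1 + Real.cos x) / x ^ 2) (fun x hx => ?_) fun x hx => ?_
    · have hx0 : 0 < x := hpi.trans_le hx
      have h := ((hasDerivAt_sineIntegral_of_pos hx0).add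
        (((Real.hasDerivAt_cos x).const_add 1).div (hasDerivAt_id x) hx0.ne')).neg
      refine h.congr_deriv ?_
      simp only [id]
      field_simp
      ring
    · exact div_nonneg (by linarith [Real.neg_one_le_cos x]) (sq_nonneg _)
  have h1 := hm (Set.mem_Ici.2 le_rfl) (Set.mem_Ici.2 h) h
  have h2 : 0 ≤ (1 + Real.cos z) / z :=
    div_nonneg (by linarith [Real.neg_one_le_cos z]) hz
  simp at h1
  linarith

/-- Integration by parts with the primitive `1 - cos` of `sin`, which vanishes at `2π`. -/
lemma sineIntegral_two_pi_le {z : ℝ} (hz : Real.pi ≤ z) :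
    sineIntegral (2 * Real.pi) ≤ sineIntegral z := by
  have hpi := Real.pi_pos
  rcases le_total z (2 * Real.pi) with h | h
  · exact sineIntegral_antitoneOn ⟨hz, h⟩ ⟨by linarith, le_rfl⟩ h
  have hm : MonotoneOn (fun x => sineIntegral x - (1 - Real.cos x) / x)
      (Set.Ici (2 * Real.pi)) := by
    refine monotoneOn_of_hasDerivAt_nonneg (convex_Ici _)
      (f' := fun x => (1 - Real.cos x) / x ^ 2) (fun x hx => ?_) fun x hx => ?_
    · have hx0 : 0 < x := (by linarith : 0 < 2 * Real.pi).trans_le hx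
      have h := (hasDerivAt_sineIntegral_of_pos hx0).sub
        (((Real.hasDerivAt_cos x).const_sub 1).div (hasDerivAt_id x) hx0.ne')
      refine h.congr_deriv ?_
      simp only [id]
      field_simp
      ring
    · exact div_nonneg (by linarith [Real.cos_le_one x]) (sq_nonneg _)
  have h1 := hm (Set.mem_Ici.2 le_rfl) (Set.mem_Ici.2 h) h
  have h2 : 0 ≤ (1 - Real.cos z) / z :=
    div_nonneg (by linarith [Real.cos_le_one z]) (hpi.le.trans hz)
  simp at h1
  linarith

/-- On `[π, 2π]`, where `sin ≤ 0`, replacing `1 / z` by an affine upper bound gives a lower bound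
for the increments of the sine integral. -/
lemma sineIntegral_sub_ge {u v α β : ℝ} (hu : Real.pi ≤ u) (huv : u ≤ v) (hv : v ≤ 2 * Real.pi)
    (h : ∀ z ∈ Set.Icc u v, 1 / z ≤ α - β * z) :
    (-(α - β * v) * Real.cos v - β * Real.sin v) - (-(α - β * u) * Real.cos u - β * Real.sin u) ≤
      sineIntegral v - sineIntegral u := by
  have hm : MonotoneOn (fun x => sineIntegral x - (-(α - β * x) * Real.cos x - β * Real.sin x))
      (Set.Icc u v) := by
    refine monotoneOn_of_hasDerivAt_nonneg (convex_Icc _ _)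
      (f' := fun x => Real.sin x * (1 / x - (α - β * x))) (fun x hx => ?_) fun x hx => ?_
    · have hx0 : 0 < x := Real.pi_pos.trans_le (hu.trans hx.1)
      have h := (hasDerivAt_sineIntegral_of_pos hx0).sub
        (((((hasDerivAt_id x).const_mul β).const_sub α).neg.mul (Real.hasDerivAt_cos x)).sub
          ((Real.hasDerivAt_sin x).const_mul β))
      refine h.congr_deriv ?_
      simp only [id, Pi.neg_apply]
      ring
    · exact mul_nonneg_of_nonpos_of_nonpos
        (sin_nonpos_of_mem_Icc_pi_two_pi ⟨hu.trans hx.1, hx.2.trans hv⟩) (by linarith [h x hx])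
  have := hm ⟨le_rfl, huv⟩ ⟨huv, le_rfl⟩ huv
  simp only at this
  linarith

lemma one_div_le_chord {a b z : ℝ} (ha : 0 < a) (hz : z ∈ Set.Icc a b) :
    1 / z ≤ (1 / a + 1 / b) - 1 / (a * b) * z := by
  have hz0 : 0 < z := ha.trans_le hz.1
  have hb : 0 < b := hz0.trans_le hz.2
  rw [← sub_nonneg]
  have : (1 / a + 1 / b) - 1 / (a * b) * z - 1 / z = (z - a) * (b - z) / (a * b * z) := by
    field_simp
    ring
  rw [this]
  exact div_nonneg (mul_nonneg (by linarith [hz.1]) (by linarith [hz.2])) (by positivity)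

lemma cos_three_pi_div_two : Real.cos (3 * Real.pi / 2) = 0 := by
  rw [show 3 * Real.pi / 2 = Real.pi / 2 + Real.pi by ring, Real.cos_add_pi]; simp

lemma sin_three_pi_div_two : Real.sin (3 * Real.pi / 2) = -1 := by
  rw [show 3 * Real.pi / 2 = Real.pi / 2 + Real.pi by ring, Real.sin_add_pi]; simp

lemma sineIntegral_three_pi_div_two_ge :
    sineIntegral Real.pi - 1 / Real.pi ≤ sineIntegral (3 * Real.pi / 2) := by
  have hpi := Real.pi_pos
  have h := sineIntegral_sub_ge (u := Real.pi) (v := 3 * Real.pi / 2) (α := 1 / Real.pi) (β := 0)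
    le_rfl (by linarith) (by linarith) fun z hz => by
      simpa using inv_anti₀ hpi hz.1
  simp [cos_three_pi_div_two, sin_three_pi_div_two] at h
  rw [one_div]
  linarith

/-- The drop of the sine integral from its maximum to its first minimum, estimated by the chords
of `1 / z` over `[π, 3π/2]` and `[3π/2, 2π]`. -/
lemma sineIntegral_two_pi_ge :
    sineIntegral Real.pi - (3 / (2 * Real.pi) - 1 / (3 * Real.pi ^ 2)) ≤
      sineIntegral (2 * Real.pi) := by
  have hpi := Real.pi_pos
  have h1 := sineIntegral_sub_ge le_rfl (by linarith) (by linarith) fun z hz =>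
    one_div_le_chord (a := Real.pi) (b := 3 * Real.pi / 2) hpi hz
  have h2 := sineIntegral_sub_ge (by linarith) (by linarith) le_rfl fun z hz =>
    one_div_le_chord (a := 3 * Real.pi / 2) (b := 2 * Real.pi) (by positivity) hz
  simp only [cos_three_pi_div_two, sin_three_pi_div_two, Real.cos_pi, Real.sin_pi,
    Real.cos_two_pi, Real.sin_two_pi] at h1 h2
  have e1 : -(1 / Real.pi + 1 / (3 * Real.pi / 2) - 1 / (Real.pi * (3 * Real.pi / 2)) *
      (3 * Real.pi / 2)) * 0 - 1 / (Real.pi * (3 * Real.pi / 2)) * -1 -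
      (-(1 / Real.pi + 1 / (3 * Real.pi / 2) - 1 / (Real.pi * (3 * Real.pi / 2)) * Real.pi) * -1 -
        1 / (Real.pi * (3 * Real.pi / 2)) * 0) = 2 / (3 * Real.pi ^ 2) - 1 / Real.pi := by
    field_simp
    ring
  have e2 : -(1 / (3 * Real.pi / 2) + 1 / (2 * Real.pi) -
      1 / (3 * Real.pi / 2 * (2 * Real.pi)) * (2 * Real.pi)) * 1 -
      1 / (3 * Real.pi / 2 * (2 * Real.pi)) * 0 -
      (-(1 / (3 * Real.pi / 2) + 1 / (2 * Real.pi) -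
        1 / (3 * Real.pi / 2 * (2 * Real.pi)) * (3 * Real.pi / 2)) * 0 -
        1 / (3 * Real.pi / 2 * (2 * Real.pi)) * -1) =
      -(1 / (2 * Real.pi)) - 1 / (3 * Real.pi ^ 2) := by
    field_simp
    ring
  rw [e1] at h1
  rw [e2] at h2
  have e3 : 3 / (2 * Real.pi) - 1 / (3 * Real.pi ^ 2) =
    -(2 / (3 * Real.pi ^ 2) - 1 / Real.pi) - (-(1 / (2 * Real.pi)) - 1 / (3 * Real.pi ^ 2)) := by
    field_simp
    ring
  linarith

/-- On `[π/2, π]` the function `1 / z` lies above its tangent at `2π/3`. -/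
lemma sineIntegral_pi_ge :
    sineIntegral (Real.pi / 2) + (3 / (4 * Real.pi) + 9 / (4 * Real.pi ^ 2)) ≤
      sineIntegral Real.pi := by
  have hpi := Real.pi_pos
  set α : ℝ := 3 / Real.pi with hα
  set β : ℝ := 9 / (4 * Real.pi ^ 2) with hβ
  have hm : MonotoneOn (fun x => sineIntegral x - (-(α - β * x) * Real.cos x - β * Real.sin x))
      (Set.Icc (Real.pi / 2) Real.pi) := by
    refine monotoneOn_of_hasDerivAt_nonneg (convex_Icc _ _)
      (f' := fun x => Real.sin x * (1 / x - (α - β * x))) (fun x hx => ?_) fun x hx => ?_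
    · have hx0 : 0 < x := (half_pos hpi).trans_le hx.1
      have h := (hasDerivAt_sineIntegral_of_pos hx0).sub
        (((((hasDerivAt_id x).const_mul β).const_sub α).neg.mul (Real.hasDerivAt_cos x)).sub
          ((Real.hasDerivAt_sin x).const_mul β))
      refine h.congr_deriv ?_
      simp only [id, Pi.neg_apply]
      ring
    · have hx0 : 0 < x := (half_pos hpi).trans_le hx.1
      refine mul_nonneg (Real.sin_nonneg_of_nonneg_of_le_pi hx0.le hx.2) ?_
      have : 1 / x - (α - β * x) = (1 - 3 * x / (2 * Real.pi)) ^ 2 / x := by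
        rw [hα, hβ]
        field_simp
        ring
      rw [this]
      positivity
  have := hm (a := Real.pi / 2) (b := Real.pi) ⟨le_rfl, by linarith⟩ ⟨by linarith, le_rfl⟩
    (by linarith)
  simp at this
  have e : 3 / (4 * Real.pi) = α - β * Real.pi := by
    rw [hα, hβ]
    field_simp
    ring
  rw [e]
  linarith

lemma sineIntegral_ge_sub_cube {z : ℝ} (hz : 0 ≤ z) : z - z ^ 3 / 18 ≤ sineIntegral z := by
  have hm : MonotoneOn (fun x => sineIntegral x - (x - x ^ 3 / 18)) (Set.Ici 0) := by
    refine monotoneOn_of_hasDerivAt_nonneg (convex_Ici _)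
      (f' := fun x => Real.sinc x - (1 - x ^ 2 / 6)) (fun x _ => ?_) fun x hx => ?_
    · refine ((hasDerivAt_sineIntegral x).sub
        ((hasDerivAt_id x).sub (((hasDerivAt_id x).pow 3).div_const 18))).congr_deriv ?_
      simp only [id]
      ring
    · rcases (Set.mem_Ici.1 hx).eq_or_lt with rfl | h0
      · simp
      · rw [Real.sinc_of_ne_zero h0.ne', sub_nonneg, le_div_iff₀ h0]
        linarith [Real.sin_gt_sub_cube h0]
  have := hm (Set.mem_Ici.2 le_rfl) (Set.mem_Ici.2 hz) hz
  simp at this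
  linarith

lemma sineIntegral_pos {z : ℝ} (hz : 0 < z) (hz' : z ≤ Real.pi) : 0 < sineIntegral z := by
  have hpi : Real.pi ≤ 4 := Real.pi_le_four
  have h := sineIntegral_ge_sub_cube hz.le
  nlinarith [mul_pos hz hz]

/-- The combination of sine integrals that governs the sign of the threshold profile. -/
noncomputable def sineIntegralCombination (z : ℝ) : ℝ :=
  sineIntegral (z / 3) - 3 * sineIntegral (z / 2) + 3 * sineIntegral z

/-- For `z ≤ π` the combination is positive as `Si` increases on `[0, π]`. Beyond `π`, the loss
`3 (Si (z / 2) - Si z)` is at most three times the drop of `Si` below its maximum `Si π`, and it is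
outweighed by `Si (z / 3)`. -/
lemma sineIntegralCombination_pos {z : ℝ} (hz : 0 < z) : 0 < sineIntegralCombination z := by
  unfold sineIntegralCombination
  have hpi := Real.pi_pos
  have hpi3 := Real.pi_gt_d2
  have hpi4 := Real.pi_lt_d2
  rcases le_total z Real.pi with h | h
  · have h1 : 0 < sineIntegral (z / 3) := sineIntegral_pos (by linarith) (by linarith)
    have h2 := sineIntegral_monotoneOn (a := z / 2) (b := z) ⟨by linarith, by linarith⟩
      ⟨hz.le, h⟩ (by linarith)
    linarith
  have hmax : sineIntegral (z / 2) ≤ sineIntegral Real.pi :=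
    sineIntegral_le_sineIntegral_pi (by linarith)
  rcases le_total z (3 * Real.pi / 2) with h' | h'
  · have h1 : sineIntegral (Real.pi / 3) ≤ sineIntegral (z / 3) :=
      sineIntegral_monotoneOn ⟨by linarith, by linarith⟩ ⟨by linarith, by linarith⟩ (by linarith)
    have h2 : sineIntegral (3 * Real.pi / 2) ≤ sineIntegral z :=
      sineIntegral_antitoneOn ⟨h, by linarith⟩ ⟨by linarith, by linarith⟩ h'
    have h3 := sineIntegral_ge_sub_cube (z := Real.pi / 3) (by positivity)
    have h4 := sineIntegral_three_pi_div_two_ge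
    have h5 : 1 / Real.pi ≤ 1 / 3.14 := one_div_le_one_div_of_le (by norm_num) hpi3.le
    have h6 : (Real.pi / 3) ^ 3 ≤ (3.15 / 3) ^ 3 := by gcongr
    norm_num at h6
    linarith
  · have h1 : sineIntegral (Real.pi / 2) ≤ sineIntegral (z / 3) := by
      rcases le_total (z / 3) Real.pi with h3 | h3
      · exact sineIntegral_monotoneOn ⟨by linarith, by linarith⟩ ⟨by linarith, h3⟩ (by linarith)
      · refine le_trans ?_ (sineIntegral_two_pi_le h3)
        have h5 := sineIntegral_pi_ge
        have h6 := sineIntegral_two_pi_ge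
        have h7 : 3 / (4 * Real.pi) + 9 / (4 * Real.pi ^ 2) -
            (3 / (2 * Real.pi) - 1 / (3 * Real.pi ^ 2)) =
            (31 - 9 * Real.pi) / (12 * Real.pi ^ 2) := by
          field_simp
          ring
        have h8 : 0 ≤ (31 - 9 * Real.pi) / (12 * Real.pi ^ 2) :=
          div_nonneg (by linarith) (by positivity)
        linarith
    have h2 := sineIntegral_two_pi_le h
    have h3 := sineIntegral_ge_sub_cube (z := Real.pi / 2) (by positivity)
    have h4 := sineIntegral_two_pi_ge
    have h5 : 1 / Real.pi ≤ 1 / 3.14 := one_div_le_one_div_of_le (by norm_num) hpi3.le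
    have h6 : (Real.pi / 2) ^ 3 ≤ (3.15 / 2) ^ 3 := by gcongr
    have h7 : 1 / (3 * 3.15 ^ 2) ≤ 1 / (3 * Real.pi ^ 2) := by gcongr
    have h8 : 3 / (2 * Real.pi) = 3 / 2 * (1 / Real.pi) := by field_simp
    norm_num only at h6
    linarith

/-! ### The symbol and its kernel -/


section Symbol

variable {E : Type*} [NormedAddCommGroup E]

/-- The exponent `-(|2πξ|⁴ + B |2πξ|²)`; the factor `2π` matches Mathlib's normalization of the
Fourier transform. -/
noncomputable def quarticPhase (B : ℝ) (ξ : E) : ℝ :=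
  -((2 * Real.pi * ‖ξ‖) ^ 4 + B * (2 * Real.pi * ‖ξ‖) ^ 2)

/-- The Fourier symbol `exp (-(|2πξ|⁴ + B |2πξ|²))` of the kernel at time one. -/
noncomputable def quarticSymbol (B : ℝ) (ξ : E) : ℂ := Complex.exp (quarticPhase B ξ : ℝ)

lemma quarticPhase_le {B : ℝ} (hB : |B| ≤ 1) (ξ : E) : quarticPhase B ξ ≤ 1 - ‖ξ‖ ^ 2 := by
  unfold quarticPhase
  set s := 2 * Real.pi * ‖ξ‖ with hs
  have h1 : ‖ξ‖ ≤ s := by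
    rw [hs]
    nlinarith [Real.pi_gt_three, norm_nonneg ξ]
  have h2 : ‖ξ‖ ^ 2 ≤ s ^ 2 := by gcongr
  nlinarith [sq_nonneg (s ^ 2 - 1), neg_abs_le B, sq_nonneg s]

lemma quarticPhase_neg (B : ℝ) (ξ : E) : quarticPhase B (-ξ) = quarticPhase B ξ := by
  simp [quarticPhase]

lemma quarticSymbol_neg (B : ℝ) (ξ : E) : quarticSymbol B (-ξ) = quarticSymbol B ξ := by
  simp [quarticSymbol, quarticPhase_neg]

variable [InnerProductSpace ℝ E]

lemma exists_norm_iteratedFDeriv_quarticPhase_le (n : ℕ) :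
    ∃ (k : ℕ) (C : ℝ), 0 ≤ C ∧ ∀ B : ℝ, |B| ≤ 1 → ∀ i ≤ n, ∀ ξ : E,
      ‖iteratedFDeriv ℝ i (quarticPhase B) ξ‖ ≤ C * (1 + ‖ξ‖) ^ k := by
  have hsq : (fun ξ : E => ‖ξ‖ ^ 2).HasTemperateGrowth :=
    Function.hasTemperateGrowth_norm_sq E
  have h4 : (fun ξ : E => -((2 * Real.pi) ^ 4 * (‖ξ‖ ^ 2) ^ 2)).HasTemperateGrowth :=
    ((Function.HasTemperateGrowth.const _).mul (hsq.pow 2)).neg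
  have h2 : (fun ξ : E => -((2 * Real.pi) ^ 2 * ‖ξ‖ ^ 2)).HasTemperateGrowth :=
    ((Function.HasTemperateGrowth.const _).mul hsq).neg
  obtain ⟨k, C, hC, hk⟩ := h4.norm_iteratedFDeriv_le_uniform n
  obtain ⟨l, D, hD, hl⟩ := h2.norm_iteratedFDeriv_le_uniform n
  refine ⟨max k l, C + D, by positivity, fun B hB i hi ξ => ?_⟩
  have e : quarticPhase (E := E) B = (fun ξ : E => -((2 * Real.pi) ^ 4 * (‖ξ‖ ^ 2) ^ 2)) +
      B • fun ξ : E => -((2 * Real.pi) ^ 2 * ‖ξ‖ ^ 2) := by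
    ext ξ
    simp only [quarticPhase, Pi.add_apply, Pi.smul_apply, smul_eq_mul]
    ring
  have c4 := (h4.1.contDiffAt (x := ξ)).of_le (m := (i : ℕ∞ω)) (by exact_mod_cast le_top)
  have c2 := (h2.1.contDiffAt (x := ξ)).of_le (m := (i : ℕ∞ω)) (by exact_mod_cast le_top)
  have c2' : ContDiffAt ℝ i (B • fun ξ : E => -((2 * Real.pi) ^ 2 * ‖ξ‖ ^ 2)) ξ :=
    contDiffAt_const.smul c2
  rw [e, iteratedFDeriv_add_apply c4 c2', iteratedFDeriv_const_smul_apply c2]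
  have h1 : (1 : ℝ) ≤ 1 + ‖ξ‖ := by linarith [norm_nonneg ξ]
  calc _ ≤ C * (1 + ‖ξ‖) ^ k + |B| * (D * (1 + ‖ξ‖) ^ l) := by
        refine (norm_add_le _ _).trans (add_le_add (hk i hi ξ) ?_)
        rw [norm_smul, Real.norm_eq_abs]
        exact mul_le_mul_of_nonneg_left (hl i hi ξ) (abs_nonneg _)
    _ ≤ C * (1 + ‖ξ‖) ^ max k l + 1 * (D * (1 + ‖ξ‖) ^ max k l) := by
        gcongr
        · exact le_max_left _ _
        · exact le_max_right _ _
    _ = _ := by ring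

lemma contDiff_quarticPhase (B : ℝ) : ContDiff ℝ ∞ (quarticPhase (E := E) B) := by
  have hsq : ContDiff ℝ ∞ (fun ξ : E => ‖ξ‖ ^ 2) := contDiff_norm_sq ℝ
  have e : quarticPhase (E := E) B = fun ξ =>
      -((2 * Real.pi) ^ 4 * (‖ξ‖ ^ 2) ^ 2 + B * ((2 * Real.pi) ^ 2 * ‖ξ‖ ^ 2)) := by
    ext ξ
    simp only [quarticPhase]
    ring
  rw [e]
  fun_prop

lemma contDiff_exp_ofReal : ContDiff ℝ ∞ (fun y : ℝ => Complex.exp y) :=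
  Complex.contDiff_exp.comp Complex.ofRealCLM.contDiff

lemma contDiff_quarticSymbol (B : ℝ) : ContDiff ℝ ∞ (quarticSymbol (E := E) B) :=
  contDiff_exp_ofReal.comp (contDiff_quarticPhase B)

lemma continuous_quarticSymbol (B : ℝ) : Continuous (quarticSymbol (E := E) B) :=
  (contDiff_quarticSymbol B).continuous

lemma iteratedDeriv_exp_ofReal (n : ℕ) :
    iteratedDeriv n (fun y : ℝ => Complex.exp y) = fun y : ℝ => Complex.exp y := by
  induction n with
  | zero => simp
  | succ n ih =>
    rw [iteratedDeriv_succ, ih]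
    ext y
    exact (Complex.hasDerivAt_exp (y : ℂ)).comp_ofReal.deriv

lemma one_add_pow_mul_exp_le (m : ℕ) {r : ℝ} (hr : 0 ≤ r) :
    (1 + r) ^ m * Real.exp (1 - r ^ 2) ≤ m.factorial * Real.exp 3 := by
  have h := Real.pow_div_factorial_le_exp (1 + r) (by linarith) m
  have hm : (0 : ℝ) < m.factorial := by exact_mod_cast m.factorial_pos
  rw [div_le_iff₀ hm] at h
  calc (1 + r) ^ m * Real.exp (1 - r ^ 2)
      ≤ Real.exp (1 + r) * m.factorial * Real.exp (1 - r ^ 2) := by gcongr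
    _ = m.factorial * Real.exp ((1 + r) + (1 - r ^ 2)) := by
      rw [Real.exp_add (1 + r)]
      ring
    _ ≤ _ := by
      gcongr
      nlinarith [sq_nonneg (r - 1 / 2)]

/-- The derivatives of the symbol decay faster than any power, uniformly for `|B| ≤ 1`. -/
lemma exists_norm_iteratedFDeriv_quarticSymbol_le (n m : ℕ) :
    ∃ C : ℝ, 0 ≤ C ∧ ∀ B : ℝ, |B| ≤ 1 → ∀ i ≤ n, ∀ ξ : E,
      ‖iteratedFDeriv ℝ i (quarticSymbol B) ξ‖ ≤ C * (1 + ‖ξ‖) ^ (-(m : ℝ)) := by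
  obtain ⟨k, C, hC, hk⟩ := exists_norm_iteratedFDeriv_quarticPhase_le (E := E) n
  refine ⟨n.factorial * (C + 1) ^ n * ((k * n + m).factorial * Real.exp 3), by positivity,
    fun B hB i hi ξ => ?_⟩
  have h1 : (1 : ℝ) ≤ 1 + ‖ξ‖ := by linarith [norm_nonneg ξ]
  set D : ℝ := (C + 1) * (1 + ‖ξ‖) ^ k with hD
  have hD1 : 1 ≤ D := one_le_mul_of_one_le_of_one_le (by linarith) (one_le_pow₀ h1)
  have h := norm_iteratedFDeriv_comp_le contDiff_exp_ofReal (contDiff_quarticPhase (E := E) B)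
    (n := i) (by exact_mod_cast le_top) ξ (C := Real.exp (quarticPhase B ξ)) (D := D)
    (fun j _ => by
      rw [norm_iteratedFDeriv_eq_norm_iteratedDeriv, iteratedDeriv_exp_ofReal, Complex.norm_exp,
        Complex.ofReal_re])
    (fun j hj hji => by
      refine (hk B hB j (hji.trans hi) ξ).trans ?_
      calc C * (1 + ‖ξ‖) ^ k ≤ D := by rw [hD]; gcongr; linarith
        _ ≤ D ^ j := le_self_pow₀ hD1 (by omega))
  have hrp : (1 + ‖ξ‖) ^ (-(m : ℝ)) = ((1 + ‖ξ‖) ^ m)⁻¹ := by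
    rw [Real.rpow_neg (by linarith), Real.rpow_natCast]
  rw [hrp, ← div_eq_mul_inv, le_div_iff₀ (by positivity)]
  calc ‖iteratedFDeriv ℝ i (quarticSymbol B) ξ‖ * (1 + ‖ξ‖) ^ m
      ≤ (i.factorial * Real.exp (quarticPhase B ξ) * D ^ i) * (1 + ‖ξ‖) ^ m := by
        gcongr
        exact h
    _ ≤ (n.factorial * Real.exp (1 - ‖ξ‖ ^ 2) * D ^ n) * (1 + ‖ξ‖) ^ m := by
        have := quarticPhase_le hB ξ
        gcongr
    _ = n.factorial * (C + 1) ^ n *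
          ((1 + ‖ξ‖) ^ (k * n + m) * Real.exp (1 - ‖ξ‖ ^ 2)) := by
        rw [hD, mul_pow, ← pow_mul, pow_add]
        ring
    _ ≤ _ := by
        exact mul_le_mul_of_nonneg_left (one_add_pow_mul_exp_le _ (norm_nonneg ξ))
          (by positivity)

end Symbol

section Kernel

variable {E : Type*} [NormedAddCommGroup E] [InnerProductSpace ℝ E] [FiniteDimensional ℝ E]
  [MeasurableSpace E] [BorelSpace E]

/-- The kernel with Fourier transform `quarticSymbol B`: the fundamental solution at time one of
`∂_t + Δ² - B Δ`. -/
noncomputable def quarticKernel (B : ℝ) (x : E) : ℝ := (𝓕⁻ (quarticSymbol (E := E) B) x).re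

lemma integrable_one_add_norm_pow :
    Integrable (fun x : E => (1 + ‖x‖) ^ (-((Module.finrank ℝ E + 1 : ℕ) : ℝ))) :=
  integrable_one_add_norm (by push_cast; linarith)

lemma integrable_iteratedFDeriv_quarticSymbol {B : ℝ} (hB : |B| ≤ 1) (i : ℕ) :
    Integrable (iteratedFDeriv ℝ i (quarticSymbol (E := E) B)) := by
  obtain ⟨C, -, h⟩ :=
    exists_norm_iteratedFDeriv_quarticSymbol_le (E := E) i (Module.finrank ℝ E + 1)
  refine (integrable_one_add_norm_pow.const_mul C).mono' ?_ (.of_forall (h B hB i le_rfl))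
  exact ((contDiff_quarticSymbol B).continuous_iteratedFDeriv
    (by exact_mod_cast le_top)).aestronglyMeasurable

lemma integrable_quarticSymbol {B : ℝ} (hB : |B| ≤ 1) :
    Integrable (quarticSymbol (E := E) B) := by
  have h := (integrable_iteratedFDeriv_quarticSymbol (E := E) hB 0).norm
  simp only [norm_iteratedFDeriv_zero] at h
  exact (integrable_norm_iff (continuous_quarticSymbol B).aestronglyMeasurable).1 h

/-- The kernel decays faster than any power, uniformly for `|B| ≤ 1`: powers of `|x|` turn into
derivatives of the symbol. -/
lemma exists_norm_fourier_quarticSymbol_le (n : ℕ) :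
    ∃ C : ℝ, 0 ≤ C ∧ ∀ B : ℝ, |B| ≤ 1 → ∀ x : E,
      ‖𝓕 (quarticSymbol (E := E) B) x‖ ≤ C * (1 + ‖x‖) ^ (-(n : ℝ)) := by
  obtain ⟨C, hC, h⟩ :=
    exists_norm_iteratedFDeriv_quarticSymbol_le (E := E) n (Module.finrank ℝ E + 1)
  set I : ℝ := ∫ x : E, C * (1 + ‖x‖) ^ (-((Module.finrank ℝ E + 1 : ℕ) : ℝ)) with hI
  have hI0 : 0 ≤ I := integral_nonneg fun x => by positivity
  have key : ∀ B : ℝ, |B| ≤ 1 → ∀ m ≤ n, ∀ x : E,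
      ‖x‖ ^ m * ‖𝓕 (quarticSymbol (E := E) B) x‖ ≤ 2 ^ n * ((n + 1) * I) := by
    intro B hB m hm x
    have h1 := Real.pow_mul_norm_iteratedFDeriv_fourier_le (K := 0) (N := ⊤) (k := 0) (n := m)
      (f := quarticSymbol (E := E) B) (contDiff_quarticSymbol B)
      (fun k j hk _ => by
        have hk0 : k = 0 := by simpa using hk
        subst hk0
        simpa using (integrable_iteratedFDeriv_quarticSymbol hB j).norm) (by simp) le_top x
    rw [norm_iteratedFDeriv_zero] at h1
    refine h1.trans ?_
    have h2 : ∀ p ∈ Finset.range (0 + 1) ×ˢ Finset.range (m + 1),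
        ∫ v : E, ‖v‖ ^ p.1 * ‖iteratedFDeriv ℝ p.2 (quarticSymbol (E := E) B) v‖ ≤ I := by
      intro p hp
      simp only [Finset.mem_product, Finset.mem_range] at hp
      have hp0 : p.1 = 0 := by omega
      rw [hp0]
      simp only [pow_zero, one_mul]
      refine integral_mono (integrable_iteratedFDeriv_quarticSymbol hB _).norm
        (integrable_one_add_norm_pow.const_mul C) fun v => h B hB p.2 (by omega) v
    have h3 := Finset.sum_le_card_nsmul _ _ _ h2
    simp only [Finset.card_product, Finset.card_range, nsmul_eq_mul] at h3
    push_cast at h3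
    calc _ ≤ (2 * Real.pi) ^ 0 * (2 * ((0 : ℕ) : ℝ) + 2) ^ m * ((0 + 1) * (m + 1) * I) := by
          refine mul_le_mul_of_nonneg_left (h3.trans_eq ?_) (by positivity)
          ring
      _ = 2 ^ m * ((m + 1) * I) := by simp
      _ ≤ _ := by
          have : (m : ℝ) ≤ n := by exact_mod_cast hm
          gcongr
          norm_num
  refine ⟨2 ^ n * (2 * (2 ^ n * ((n + 1) * I))), by positivity, fun B hB x => ?_⟩
  have h1 : (1 : ℝ) ≤ 1 + ‖x‖ := by linarith [norm_nonneg x]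
  have hrp : (1 + ‖x‖) ^ (-(n : ℝ)) = ((1 + ‖x‖) ^ n)⁻¹ := by
    rw [Real.rpow_neg (by linarith), Real.rpow_natCast]
  rw [hrp, ← div_eq_mul_inv, le_div_iff₀ (by positivity)]
  have h2 : (1 + ‖x‖) ^ n ≤ 2 ^ n * (1 + ‖x‖ ^ n) := by
    refine (add_pow_le zero_le_one (norm_nonneg x) n).trans ?_
    rw [one_pow]
    gcongr
    · norm_num
    · omega
  have h3 := key B hB 0 (Nat.zero_le _) x
  have h4 := key B hB n le_rfl x
  rw [pow_zero, one_mul] at h3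
  calc _ ≤ ‖𝓕 (quarticSymbol (E := E) B) x‖ * (2 ^ n * (1 + ‖x‖ ^ n)) := by gcongr
    _ = 2 ^ n * (‖𝓕 (quarticSymbol (E := E) B) x‖ +
          ‖x‖ ^ n * ‖𝓕 (quarticSymbol (E := E) B) x‖) := by ring
    _ ≤ _ := by
      gcongr
      linarith

lemma fourierInv_quarticSymbol_neg (B : ℝ) (x : E) :
    𝓕⁻ (quarticSymbol (E := E) B) (-x) = 𝓕⁻ (quarticSymbol (E := E) B) x := by
  rw [Real.fourierInv_eq', Real.fourierInv_eq',
    ← integral_neg_eq_self (fun v : E => Complex.exp (↑(2 * Real.pi * inner ℝ v x) * Complex.I) •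
      quarticSymbol B v)]
  simp [quarticSymbol_neg]

lemma fourier_quarticSymbol (B : ℝ) :
    𝓕 (quarticSymbol (E := E) B) = 𝓕⁻ (quarticSymbol (E := E) B) := by
  ext x
  rw [← fourierInv_quarticSymbol_neg, Real.fourierInv_eq_fourier_neg, neg_neg]

/-- The kernel is real because the symbol is real and even. -/
lemma ofReal_quarticKernel (B : ℝ) (x : E) :
    (quarticKernel B x : ℂ) = 𝓕⁻ (quarticSymbol (E := E) B) x := by
  apply Complex.conj_eq_iff_re.1
  rw [Real.fourierInv_eq', ← integral_conj]
  refine (integral_neg_eq_self _ _).symm.trans ?_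
  congr 1
  ext v
  simp only [smul_eq_mul, map_mul, quarticSymbol, ← Complex.exp_conj, Complex.conj_ofReal,
    Complex.conj_I, inner_neg_left, quarticPhase_neg]
  congr 2
  push_cast
  ring

lemma quarticKernel_neg (B : ℝ) (x : E) : quarticKernel B (-x) = quarticKernel B x := by
  rw [quarticKernel, fourierInv_quarticSymbol_neg, quarticKernel]

lemma exists_abs_quarticKernel_le (E : Type*) [NormedAddCommGroup E] [InnerProductSpace ℝ E]
    [FiniteDimensional ℝ E] [MeasurableSpace E] [BorelSpace E] (n : ℕ) :
    ∃ C : ℝ, 0 ≤ C ∧ ∀ B : ℝ, |B| ≤ 1 → ∀ x : E,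
      |quarticKernel B x| ≤ C * (1 + ‖x‖) ^ (-(n : ℝ)) := by
  obtain ⟨C, hC, h⟩ := exists_norm_fourier_quarticSymbol_le (E := E) n
  refine ⟨C, hC, fun B hB x => ?_⟩
  have := h B hB x
  rw [fourier_quarticSymbol] at this
  exact (Complex.abs_re_le_norm _).trans this

lemma continuous_quarticKernel {B : ℝ} (hB : |B| ≤ 1) :
    Continuous (quarticKernel (E := E) B) := by
  refine Complex.continuous_re.comp ?_
  rw [← fourier_quarticSymbol]
  exact VectorFourier.fourierIntegral_continuous Real.continuous_fourierChar
    continuous_inner (integrable_quarticSymbol hB)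

lemma integrable_quarticKernel {B : ℝ} (hB : |B| ≤ 1) :
    Integrable (quarticKernel (E := E) B) := by
  obtain ⟨C, -, h⟩ := exists_abs_quarticKernel_le E (Module.finrank ℝ E + 1)
  exact (integrable_one_add_norm_pow.const_mul C).mono'
    (continuous_quarticKernel hB).aestronglyMeasurable (.of_forall (h B hB))

/-- Fourier inversion for the kernel. -/
lemma integral_exp_mul_quarticKernel {B : ℝ} (hB : |B| ≤ 1) (w : E) :
    ∫ y : E, Complex.exp ((⟪y, w⟫ : ℝ) * Complex.I) * (quarticKernel B y : ℂ) =
      quarticSymbol B ((2 * Real.pi)⁻¹ • w) := by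
  have hint : Integrable (𝓕 (quarticSymbol (E := E) B)) := by
    rw [fourier_quarticSymbol]
    refine (integrable_quarticKernel (E := E) hB).ofReal.congr (.of_forall fun x => ?_)
    exact ofReal_quarticKernel B x
  have h := congrFun ((continuous_quarticSymbol (E := E) B).fourierInv_fourier_eq
    (integrable_quarticSymbol hB) hint) ((2 * Real.pi)⁻¹ • w)
  rw [Real.fourierInv_eq', fourier_quarticSymbol] at h
  rw [← h]
  congr 1
  ext y
  rw [smul_eq_mul, ofReal_quarticKernel, inner_smul_right]
  congr 4
  field_simp

lemma integral_quarticKernel {B : ℝ} (hB : |B| ≤ 1) : ∫ y : E, quarticKernel B y = 1 := by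
  have h := integral_exp_mul_quarticKernel (E := E) hB 0
  simp only [inner_zero_right, Complex.ofReal_zero, zero_mul, Complex.exp_zero, one_mul,
    integral_complex_ofReal, smul_zero, quarticSymbol, quarticPhase, norm_zero] at h
  norm_num at h
  exact_mod_cast h

/-- The kernel depends continuously on the coefficient of the second-order term. -/
lemma tendsto_quarticKernel {ι : Type*} {l : Filter ι} [l.IsCountablyGenerated] {B : ι → ℝ}
    (hB : Tendsto B l (𝓝 0)) (x : E) :
    Tendsto (fun i => quarticKernel (B i) x) l (𝓝 (quarticKernel 0 x)) := by
  refine (Complex.continuous_re.tendsto _).comp ?_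
  simp only [Real.fourierInv_eq]
  have hB1 : ∀ᶠ i in l, |B i| ≤ 1 := by
    filter_upwards [hB.eventually (Metric.ball_mem_nhds 0 one_pos)] with i hi
    simpa using (Metric.mem_ball.1 hi).le
  obtain ⟨C, -, hC⟩ :=
    exists_norm_iteratedFDeriv_quarticSymbol_le (E := E) 0 (Module.finrank ℝ E + 1)
  refine tendsto_integral_filter_of_dominated_convergence
    (fun v => C * (1 + ‖v‖) ^ (-((Module.finrank ℝ E + 1 : ℕ) : ℝ))) (.of_forall fun i => ?_) ?_
    (integrable_one_add_norm_pow.const_mul C) (.of_forall fun v => ?_)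
  · have := continuous_quarticSymbol (E := E) (B i)
    exact Continuous.aestronglyMeasurable (by fun_prop)
  · filter_upwards [hB1] with i hi
    refine .of_forall fun v => ?_
    simpa using hC (B i) hi 0 le_rfl v
  · refine Tendsto.const_smul ?_ _
    have : Continuous fun b : ℝ => quarticSymbol b v := by
      unfold quarticSymbol quarticPhase
      fun_prop
    exact (this.tendsto 0).comp hB

/-- Uniform decay in `B` gives convergence of integrals of the kernel against bounded functions
that converge almost everywhere. -/
lemma tendsto_integral_quarticKernel_mul {ι : Type*} {l : Filter ι} [l.IsCountablyGenerated]
    {B : ι → ℝ} (hB : Tendsto B l (𝓝 0)) {χ : ι → E → ℝ} {χ₀ : E → ℝ}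
    (hm : ∀ i, AEStronglyMeasurable (χ i)) (hb : ∀ i z, |χ i z| ≤ 1)
    (h : ∀ᵐ z : E, Tendsto (fun i => χ i z) l (𝓝 (χ₀ z))) :
    Tendsto (fun i => ∫ z : E, quarticKernel (B i) z * χ i z) l
      (𝓝 (∫ z : E, quarticKernel 0 z * χ₀ z)) := by
  have hB1 : ∀ᶠ i in l, |B i| ≤ 1 := by
    filter_upwards [hB.eventually (Metric.ball_mem_nhds 0 one_pos)] with i hi
    simpa using (Metric.mem_ball.1 hi).le
  obtain ⟨C, hC0, hC⟩ := exists_abs_quarticKernel_le E (Module.finrank ℝ E + 1)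
  refine tendsto_integral_filter_of_dominated_convergence
    (fun v => C * (1 + ‖v‖) ^ (-((Module.finrank ℝ E + 1 : ℕ) : ℝ))) ?_ ?_
    (integrable_one_add_norm_pow.const_mul C) ?_
  · filter_upwards [hB1] with i hi
    exact (continuous_quarticKernel hi).aestronglyMeasurable.mul (hm i)
  · filter_upwards [hB1] with i hi
    refine .of_forall fun v => ?_
    rw [norm_mul, Real.norm_eq_abs, Real.norm_eq_abs]
    refine (mul_le_of_le_one_right (abs_nonneg _) (hb i v)).trans (hC (B i) hi v)
  · filter_upwards [h] with z hz
    exact (tendsto_quarticKernel hB z).mul hz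

end Kernel

/-! ### The one-dimensional profile -/

/-- The primitive, vanishing at `0`, of the kernel on the line without second-order term. The
solution starting from a half-space is `1 / 2 + lineProfile` of the scaled distance. -/
noncomputable def lineProfile (s : ℝ) : ℝ := ∫ x in (0 : ℝ)..s, quarticKernel (0 : ℝ) x

lemma lineProfile_neg (s : ℝ) : lineProfile (-s) = -lineProfile s := by
  have h := intervalIntegral.integral_comp_neg (a := 0) (b := s) (quarticKernel (E := ℝ) 0)
  simp only [quarticKernel_neg, neg_zero] at h
  rw [lineProfile, lineProfile, h, intervalIntegral.integral_symm]

lemma quarticPhase_zero_real (v : ℝ) : quarticPhase 0 v = -(2 * Real.pi * v) ^ 4 := by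
  have : |v| ^ 4 = v ^ 4 := (by decide : Even 4).pow_abs v
  rw [quarticPhase, Real.norm_eq_abs, mul_pow, mul_pow (2 * Real.pi) v, this]
  ring

lemma quarticKernel_real (x : ℝ) :
    quarticKernel 0 x =
      ∫ v : ℝ, Real.exp (-(2 * Real.pi * v) ^ 4) * Real.cos (2 * Real.pi * v * x) := by
  rw [quarticKernel, Real.fourierInv_eq', ← RCLike.re_eq_complex_re, ← integral_re]
  · congr 1
    ext v
    rw [RCLike.re_eq_complex_re, smul_eq_mul, quarticSymbol, ← Complex.ofReal_exp,
      Complex.re_mul_ofReal, Complex.exp_ofReal_mul_I_re, quarticPhase_zero_real, mul_comm]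
    simp [mul_comm, mul_assoc]
  · have h := integrable_quarticSymbol (E := ℝ) (B := 0) (by simp)
    refine (integrable_norm_iff ?_).1 ?_
    · have := continuous_quarticSymbol (E := ℝ) 0
      exact Continuous.aestronglyMeasurable (by fun_prop)
    · refine h.norm.congr (.of_forall fun v => ?_)
      simp only [smul_eq_mul, norm_mul, Complex.norm_exp_ofReal_mul_I, one_mul]

lemma integrable_one_add_abs_pow_mul_exp (k : ℕ) :
    Integrable fun v : ℝ => (1 + |v|) ^ k * Real.exp (1 - |v| ^ 2) := by
  refine ((integrable_one_add_norm_pow (E := ℝ)).const_mul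
    ((k + 2).factorial * Real.exp 3)).mono' (Continuous.aestronglyMeasurable (by fun_prop))
    (.of_forall fun v => ?_)
  have h := one_add_pow_mul_exp_le (k + 2) (abs_nonneg v)
  have h1 : 0 < 1 + |v| := by positivity
  rw [Real.rpow_neg (by positivity), Real.rpow_natCast, ← div_eq_mul_inv,
    le_div_iff₀ (by positivity), Real.norm_of_nonneg (by positivity), Module.finrank_self]
  refine le_trans (le_of_eq ?_) h
  rw [Real.norm_eq_abs]
  ring

lemma exp_neg_two_pi_mul_pow_four_le (v : ℝ) :
    Real.exp (-(2 * Real.pi * v) ^ 4) ≤ Real.exp (1 - |v| ^ 2) := by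
  have := quarticPhase_le (B := 0) (by simp) v
  rw [quarticPhase_zero_real] at this
  exact Real.exp_le_exp.2 this

lemma integral_cos_two_pi_mul (v s : ℝ) :
    ∫ x in (0 : ℝ)..s, Real.cos (2 * Real.pi * v * x) = s * Real.sinc (2 * Real.pi * s * v) := by
  rcases eq_or_ne v 0 with rfl | hv
  · simp
  rcases eq_or_ne s 0 with rfl | hs
  · simp
  have hpi := Real.pi_pos.ne'
  rw [intervalIntegral.integral_comp_mul_left _ (by positivity), integral_cos,
    Real.sinc_of_ne_zero (by positivity), show 2 * Real.pi * s * v = 2 * Real.pi * v * s by ring]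
  simp
  field_simp

lemma lineProfile_eq_integral_sinc (s : ℝ) : lineProfile s =
    ∫ v : ℝ, Real.exp (-(2 * Real.pi * v) ^ 4) * (s * Real.sinc (2 * Real.pi * s * v)) := by
  simp only [lineProfile, quarticKernel_real]
  rw [intervalIntegral_integral_swap]
  · simp only [intervalIntegral.integral_const_mul, integral_cos_two_pi_mul]
  · have h0 := integrable_one_add_abs_pow_mul_exp 0
    have : IsFiniteMeasure (volume.restrict (Set.uIoc 0 s)) :=
      ⟨by rw [Measure.restrict_apply_univ, Set.uIoc]; exact measure_Ioc_lt_top⟩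
    have h1 : Integrable (fun _ : ℝ => (1 : ℝ)) (volume.restrict (Set.uIoc 0 s)) :=
      integrable_const _
    refine (h1.mul_prod h0).mono' (Continuous.aestronglyMeasurable (by fun_prop))
      (.of_forall fun z => ?_)
    simp only [Function.uncurry, norm_mul, Real.norm_eq_abs, Real.abs_exp, pow_zero, one_mul]
    exact (mul_le_of_le_one_right (Real.exp_pos _).le (Real.abs_cos_le_one _)).trans
      (exp_neg_two_pi_mul_pow_four_le _)

/-- The weight with which sine integrals average to the profile: `-1 / (2π)` times the derivative
of the one-dimensional symbol. -/
noncomputable def profileWeight (v : ℝ) : ℝ :=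
  4 * (2 * Real.pi) ^ 3 * v ^ 3 * Real.exp (-(2 * Real.pi * v) ^ 4)

lemma continuous_profileWeight : Continuous profileWeight := by
  unfold profileWeight
  fun_prop

lemma integrable_profileWeight_mul_sineIntegral (c : ℝ) :
    Integrable fun v => profileWeight v * sineIntegral (c * v) := by
  refine ((integrable_one_add_abs_pow_mul_exp 4).const_mul
    (4 * (2 * Real.pi) ^ 3 * |c|)).mono' ?_ (.of_forall fun v => ?_)
  · have h1 := continuous_profileWeight
    have h2 := continuous_sineIntegral
    exact Continuous.aestronglyMeasurable (by fun_prop)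
  · have h1 : |v| ≤ 1 + |v| := by linarith
    have h2 := abs_sineIntegral_le (c * v)
    have h3 := exp_neg_two_pi_mul_pow_four_le v
    have h4 : |profileWeight v| =
        4 * (2 * Real.pi) ^ 3 * |v| ^ 3 * Real.exp (-(2 * Real.pi * v) ^ 4) := by
      rw [profileWeight, abs_mul, abs_mul, abs_pow, Real.abs_exp,
        abs_of_nonneg (by positivity : 0 ≤ 4 * (2 * Real.pi) ^ 3)]
    rw [norm_mul, Real.norm_eq_abs, Real.norm_eq_abs, h4]
    calc _ ≤ (4 * (2 * Real.pi) ^ 3 * (1 + |v|) ^ 3 * Real.exp (1 - |v| ^ 2)) *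
          (|c| * (1 + |v|)) := by
          rw [abs_mul] at h2
          have h5 : |sineIntegral (c * v)| ≤ |c| * (1 + |v|) :=
            h2.trans (mul_le_mul_of_nonneg_left h1 (abs_nonneg c))
          gcongr
      _ = _ := by ring

/-- Integration by parts writes the profile as an average of sine integrals. -/
lemma lineProfile_eq_integral_sineIntegral (s : ℝ) :
    lineProfile s = ∫ v : ℝ, profileWeight v * sineIntegral (2 * Real.pi * s * v) := by
  have hpi := Real.pi_pos.ne'
  rw [lineProfile_eq_integral_sinc]
  have hu : ∀ v : ℝ, HasDerivAt (fun v : ℝ => Real.exp (-(2 * Real.pi * v) ^ 4))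
      (-(2 * Real.pi) * profileWeight v) v := fun v => by
    have h := ((((hasDerivAt_id v).const_mul (2 * Real.pi)).pow 4).neg).exp
    refine h.congr_deriv ?_
    simp only [profileWeight, id, Pi.neg_apply, Pi.pow_apply]
    push_cast
    ring
  have hv : ∀ v : ℝ, HasDerivAt (fun v : ℝ => sineIntegral (2 * Real.pi * s * v) / (2 * Real.pi))
      (s * Real.sinc (2 * Real.pi * s * v)) v := fun v => by
    have h := ((hasDerivAt_sineIntegral (2 * Real.pi * s * v)).comp v
      ((hasDerivAt_id v).const_mul (2 * Real.pi * s))).div_const (2 * Real.pi)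
    refine h.congr_deriv ?_
    field_simp
  have hexp : ∀ C : ℝ, ∀ f : ℝ → ℝ, Continuous f → (∀ v, |f v| ≤ C * (1 + |v|)) →
      Integrable fun v => Real.exp (-(2 * Real.pi * v) ^ 4) * f v := by
    intro C f hf hC
    refine ((integrable_one_add_abs_pow_mul_exp 1).const_mul C).mono'
      (Continuous.aestronglyMeasurable (by fun_prop)) (.of_forall fun v => ?_)
    rw [norm_mul, Real.norm_eq_abs, Real.norm_eq_abs, Real.abs_exp]
    calc _ ≤ Real.exp (1 - |v| ^ 2) * (C * (1 + |v|)) :=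
          mul_le_mul (exp_neg_two_pi_mul_pow_four_le v) (hC v) (abs_nonneg _) (Real.exp_pos _).le
      _ = _ := by ring
  have hsinc := Real.continuous_sinc
  have hSi := continuous_sineIntegral
  rw [integral_mul_deriv_eq_deriv_mul_of_integrable (fun v _ => hu v) (fun v _ => hv v),
    ← integral_neg]
  · congr 1
    ext v
    field_simp
  · refine hexp |s| _ (by fun_prop) fun v => ?_
    rw [abs_mul]
    exact mul_le_mul_of_nonneg_left ((Real.abs_sinc_le_one _).trans (by linarith [abs_nonneg v]))
      (abs_nonneg s)
  · refine (integrable_profileWeight_mul_sineIntegral (2 * Real.pi * s)).neg.congr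
      (.of_forall fun v => ?_)
    simp only [Pi.neg_apply, Pi.mul_apply]
    field_simp
  · refine hexp |s| _ (by fun_prop) fun v => ?_
    rw [abs_div, abs_of_pos Real.two_pi_pos, div_le_iff₀ Real.two_pi_pos]
    refine (abs_sineIntegral_le _).trans ?_
    rw [abs_mul, abs_mul, abs_of_pos Real.two_pi_pos]
    nlinarith [mul_nonneg Real.two_pi_pos.le (abs_nonneg s)]

/-- The profile of the threshold function, up to the constant `1 / 2` and the scale `a`. -/
noncomputable def thresholdProfile (s : ℝ) : ℝ :=
  lineProfile (s / 3) - 3 * lineProfile (s / 2) + 3 * lineProfile s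

lemma thresholdProfile_neg (s : ℝ) : thresholdProfile (-s) = -thresholdProfile s := by
  simp only [thresholdProfile, neg_div, lineProfile_neg]
  ring

lemma sineIntegralCombination_neg (z : ℝ) :
    sineIntegralCombination (-z) = -sineIntegralCombination z := by
  simp only [sineIntegralCombination, neg_div, sineIntegral_neg]
  ring

lemma thresholdProfile_pos {s : ℝ} (hs : 0 < s) : 0 < thresholdProfile s := by
  have i1 := integrable_profileWeight_mul_sineIntegral (2 * Real.pi * (s / 3))
  have i2 := (integrable_profileWeight_mul_sineIntegral (2 * Real.pi * (s / 2))).const_mul 3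
  have i3 := (integrable_profileWeight_mul_sineIntegral (2 * Real.pi * s)).const_mul 3
  have hfun : (fun v => profileWeight v * sineIntegral (2 * Real.pi * (s / 3) * v) -
      3 * (profileWeight v * sineIntegral (2 * Real.pi * (s / 2) * v)) +
      3 * (profileWeight v * sineIntegral (2 * Real.pi * s * v))) =
      fun v => profileWeight v * sineIntegralCombination (2 * Real.pi * s * v) := by
    ext v
    rw [sineIntegralCombination, show 2 * Real.pi * (s / 3) * v = 2 * Real.pi * s * v / 3 by ring,
      show 2 * Real.pi * (s / 2) * v = 2 * Real.pi * s * v / 2 by ring]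
    ring
  have hint := (i1.sub i2).add i3
  have e : thresholdProfile s =
      ∫ v : ℝ, profileWeight v * sineIntegralCombination (2 * Real.pi * s * v) := by
    simp only [thresholdProfile, lineProfile_eq_integral_sineIntegral]
    rw [← hfun, ← integral_const_mul, ← integral_const_mul,
      ← integral_sub i1 i2]
    exact (integral_add (i1.sub i2) i3).symm
  have hpos : ∀ v ≠ 0, 0 < profileWeight v * sineIntegralCombination (2 * Real.pi * s * v) := by
    have hp : ∀ v : ℝ, 0 < v →
        0 < profileWeight v * sineIntegralCombination (2 * Real.pi * s * v) := fun v hv =>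
      mul_pos (by unfold profileWeight; positivity) (sineIntegralCombination_pos (by positivity))
    intro v hv
    rcases lt_or_gt_of_ne hv with h | h
    · have h1 := hp (-v) (by linarith)
      rw [mul_neg, sineIntegralCombination_neg] at h1
      have h2 : profileWeight (-v) = -profileWeight v := by
        unfold profileWeight
        ring_nf
      rwa [h2, neg_mul_neg] at h1
    · exact hp v h
  rw [e, integral_pos_iff_support_of_nonneg]
  · refine lt_of_lt_of_le ?_ (measure_mono (s := Set.Ioi (0 : ℝ)) fun v hv => (hpos v hv.ne').ne')
    simp
  · intro v
    rcases eq_or_ne v 0 with rfl | hv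
    · simp [profileWeight]
    · exact (hpos v hv).le
  · rw [← hfun]
    exact hint

lemma thresholdProfile_ne_zero {s : ℝ} (hs : s ≠ 0) : thresholdProfile s ≠ 0 := by
  rcases lt_or_gt_of_ne hs with h | h
  · have := thresholdProfile_pos (s := -s) (by linarith)
    rw [thresholdProfile_neg] at this
    linarith
  · exact (thresholdProfile_pos h).ne'

/-! ### Integrals of the kernel over half-spaces -/

/-- Integrating a character against the positive and negative parts of a density. -/
lemma integral_exp_withDensity_sub {β : Type*} [MeasurableSpace β] {ν : Measure β} {k M : β → ℝ}
    (θ : ℝ) (hk : Measurable k) (hki : Integrable k ν) (hM : Measurable M) :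
    (∫ y, Complex.exp ((⟪M y, θ⟫ : ℝ) * Complex.I) ∂(ν.withDensity fun x => ENNReal.ofReal (k x)))
      - (∫ y, Complex.exp ((⟪M y, θ⟫ : ℝ) * Complex.I)
          ∂(ν.withDensity fun x => ENNReal.ofReal (-k x))) =
      ∫ y, Complex.exp ((M y * θ : ℝ) * Complex.I) * k y ∂ν := by
  have hkn : Measurable fun x => -k x := hk.neg
  rw [integral_withDensity_eq_integral_toReal_smul hk.ennreal_ofReal (by simp),
    integral_withDensity_eq_integral_toReal_smul hkn.ennreal_ofReal (by simp), ← integral_sub]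
  · congr 1
    ext y
    rw [ENNReal.toReal_ofReal', ENNReal.toReal_ofReal', ← sub_smul]
    have h : max (k y) 0 - max (-k y) 0 = k y := by
      rcases le_total (k y) 0 with h | h
      · rw [max_eq_right h, max_eq_left (by linarith)]; ring
      · rw [max_eq_left h, max_eq_right (by linarith)]; ring
    rw [h, Complex.real_smul, mul_comm, real_inner_comm]
    rfl
  all_goals
    refine hki.norm.mono' (Measurable.aestronglyMeasurable (by fun_prop)) (.of_forall fun y => ?_)
    rw [norm_smul, Complex.norm_exp_ofReal_mul_I, mul_one, ENNReal.toReal_ofReal',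
      Real.norm_of_nonneg (le_max_right _ _)]
    exact max_le (by first | exact le_abs_self _ | exact neg_le_abs _) (norm_nonneg _)

/-- Two signed densities, the first pushed forward by `L`, agree if their characteristic functions
do. The positive and negative parts are moved to different sides to work with finite measures. -/
lemma setIntegral_preimage_eq_of_charFun {α : Type*} [MeasurableSpace α] {μ : Measure α}
    {f : α → ℝ} {g : ℝ → ℝ} {L : α → ℝ} (hf : Integrable f μ) (hfm : Measurable f)
    (hg : Integrable g) (hgm : Measurable g) (hL : Measurable L)
    (h : ∀ θ : ℝ, ∫ y, Complex.exp ((L y * θ : ℝ) * Complex.I) * f y ∂μ =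
      ∫ s : ℝ, Complex.exp ((s * θ : ℝ) * Complex.I) * g s)
    {S : Set ℝ} (hS : MeasurableSet S) :
    ∫ y in L ⁻¹' S, f y ∂μ = ∫ s in S, g s := by
  set fp := μ.withDensity fun x => ENNReal.ofReal (f x) with hfp
  set fn := μ.withDensity fun x => ENNReal.ofReal (-f x) with hfn
  set gp := (volume : Measure ℝ).withDensity fun x => ENNReal.ofReal (g x) with hgp
  set gn := (volume : Measure ℝ).withDensity fun x => ENNReal.ofReal (-g x) with hgn
  have : IsFiniteMeasure fp := isFiniteMeasure_withDensity_ofReal hf.2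
  have : IsFiniteMeasure fn := isFiniteMeasure_withDensity_ofReal hf.neg.2
  have : IsFiniteMeasure gp := isFiniteMeasure_withDensity_ofReal hg.2
  have : IsFiniteMeasure gn := isFiniteMeasure_withDensity_ofReal hg.neg.2
  have hbound : ∀ (θ : ℝ) (ν : Measure ℝ) [IsFiniteMeasure ν],
      Integrable (fun s : ℝ => Complex.exp ((⟪s, θ⟫ : ℝ) * Complex.I)) ν := fun θ ν _ => by
    refine (integrable_const (1 : ℝ)).mono' (Continuous.aestronglyMeasurable (by fun_prop)) ?_
    exact .of_forall fun s => (Complex.norm_exp_ofReal_mul_I _).le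
  have hmeas : fp.map L + gn = fn.map L + gp := by
    refine Measure.ext_of_charFun ?_
    ext θ
    have h1 := integral_exp_withDensity_sub θ hfm hf hL
    have h2 := integral_exp_withDensity_sub θ hgm hg measurable_id
    rw [h θ] at h1
    simp only [id] at h2
    rw [charFun_apply, charFun_apply, integral_add_measure (hbound θ _) (hbound θ _),
      integral_add_measure (hbound θ _) (hbound θ _),
      integral_map hL.aemeasurable (Continuous.aestronglyMeasurable (by fun_prop)),
      integral_map hL.aemeasurable (Continuous.aestronglyMeasurable (by fun_prop))]
    rw [← h2] at h1
    linear_combination h1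
  have hmS := congrArg (fun m : Measure ℝ => (m S).toReal) hmeas
  simp only [Measure.add_apply, Measure.map_apply hL hS] at hmS
  rw [ENNReal.toReal_add (measure_ne_top _ _) (measure_ne_top _ _),
    ENNReal.toReal_add (measure_ne_top _ _) (measure_ne_top _ _), hfp, hfn, hgp, hgn,
    withDensity_apply _ (hL hS), withDensity_apply _ (hL hS), withDensity_apply _ hS,
    withDensity_apply _ hS] at hmS
  rw [integral_eq_lintegral_pos_part_sub_lintegral_neg_part hf.integrableOn,
    integral_eq_lintegral_pos_part_sub_lintegral_neg_part hg.integrableOn]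
  linarith

section HalfSpace

variable {E : Type*} [NormedAddCommGroup E] [InnerProductSpace ℝ E] [FiniteDimensional ℝ E]
  [MeasurableSpace E] [BorelSpace E]

/-- The marginal of the kernel in a unit direction is the one-dimensional kernel. -/
lemma setIntegral_quarticKernel_preimage {n : E} (hn : ‖n‖ = 1) {S : Set ℝ}
    (hS : MeasurableSet S) :
    ∫ y in (fun y : E => ⟪n, y⟫) ⁻¹' S, quarticKernel 0 y = ∫ s in S, quarticKernel (0 : ℝ) s := by
  have h0 : |(0 : ℝ)| ≤ 1 := by simp
  refine setIntegral_preimage_eq_of_charFun (integrable_quarticKernel h0)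
    (continuous_quarticKernel h0).measurable (integrable_quarticKernel h0)
    (continuous_quarticKernel h0).measurable (by fun_prop) (fun θ => ?_) hS
  have h1 := integral_exp_mul_quarticKernel (E := E) h0 (θ • n)
  have h2 := integral_exp_mul_quarticKernel (E := ℝ) h0 θ
  have h3 : quarticSymbol 0 ((2 * Real.pi)⁻¹ • θ • n) = quarticSymbol 0 ((2 * Real.pi)⁻¹ • θ) := by
    simp only [quarticSymbol, quarticPhase, norm_smul, hn, mul_one]
  rw [h3, ← h2] at h1
  convert h1 using 4 with y s y
  · rw [inner_smul_right, real_inner_comm, mul_comm θ]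
  · rw [real_inner_comm]
    rfl

/-- The line kernel is even with integral `1`. -/
lemma setIntegral_Ioi_zero_quarticKernel :
    ∫ s in Set.Ioi (0 : ℝ), quarticKernel (0 : ℝ) s = 1 / 2 := by
  have h0 : |(0 : ℝ)| ≤ 1 := by simp
  have hi := integrable_quarticKernel (E := ℝ) h0
  have h1 := intervalIntegral.integral_Iic_add_Ioi (b := 0) hi.integrableOn hi.integrableOn
  rw [integral_quarticKernel h0] at h1
  have h2 := integral_comp_neg_Iic (0 : ℝ) (quarticKernel (E := ℝ) 0)
  simp only [quarticKernel_neg, neg_zero] at h2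
  linarith

lemma integral_quarticKernel_mul_indicator_halfSpace {n : E} (hn : ‖n‖ = 1) (c : ℝ) :
    ∫ y : E, quarticKernel 0 y * {z : E | c < ⟪n, z⟫}.indicator (fun _ => (1 : ℝ)) y =
      1 / 2 - lineProfile c := by
  have h0 : |(0 : ℝ)| ≤ 1 := by simp
  have hi := integrable_quarticKernel (E := ℝ) h0
  have hS : MeasurableSet {z : E | c < ⟪n, z⟫} :=
    measurableSet_lt measurable_const (by fun_prop)
  have e : (fun y : E => quarticKernel 0 y * {z : E | c < ⟪n, z⟫}.indicator (fun _ => (1 : ℝ)) y) =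
      {z : E | c < ⟪n, z⟫}.indicator (quarticKernel 0) := by
    ext y
    by_cases hy : y ∈ {z : E | c < ⟪n, z⟫} <;> simp [hy]
  rw [e, integral_indicator hS]
  have h := setIntegral_quarticKernel_preimage hn (measurableSet_Ioi (a := c))
  have h1 := intervalIntegral.integral_interval_add_Ioi (a := 0) (b := c) hi.integrableOn
    hi.integrableOn (f := quarticKernel (E := ℝ) 0) (μ := volume)
  rw [setIntegral_Ioi_zero_quarticKernel] at h1
  change ∫ y in (fun y : E => ⟪n, y⟫) ⁻¹' Set.Ioi c, quarticKernel 0 y = _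
  rw [h, lineProfile]
  linarith

end HalfSpace

/-! ### Parabolic scaling of the solution -/

section Solution

variable {N : ℕ}

lemma fundamentalSolution_pow_four (lam : ℝ) {τ : ℝ} (hτ : 0 < τ)
    (x : EuclideanSpace ℝ (Fin N)) :
    fundamentalSolution N lam x (τ ^ 4) =
      (τ ^ N)⁻¹ * quarticKernel (lam * τ ^ 2) (τ⁻¹ • x) := by
  have hpi := Real.pi_pos
  set f : EuclideanSpace ℝ (Fin N) → ℂ := fun ξ =>
    Complex.exp (((-((‖ξ‖ ^ 4 + lam * ‖ξ‖ ^ 2) * τ ^ 4) : ℝ) : ℂ) +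
        Complex.I * ((⟪x, ξ⟫ : ℝ) : ℂ)) with hf
  have h := Measure.integral_comp_smul volume f (2 * Real.pi / τ)
  have e : 𝓕⁻ (quarticSymbol (E := EuclideanSpace ℝ (Fin N)) (lam * τ ^ 2)) (τ⁻¹ • x) =
      ∫ v, f ((2 * Real.pi / τ) • v) := by
    rw [Real.fourierInv_eq']
    congr 1
    ext v
    rw [smul_eq_mul, quarticSymbol, ← Complex.exp_add, hf]
    simp only [quarticPhase, norm_smul, inner_smul_right, Real.norm_eq_abs,
      abs_of_pos (by positivity : 0 < 2 * Real.pi / τ)]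
    rw [real_inner_comm v x, add_comm, mul_comm _ Complex.I]
    congr 3
    · congr 1
      field_simp
    · congr 1
      field_simp
  rw [quarticKernel, e, h, fundamentalSolution, finrank_euclideanSpace_fin, Complex.smul_re,
    abs_of_pos (by positivity), smul_eq_mul, ← mul_assoc]
  congr 1
  rw [div_pow]
  field_simp

lemma solution_pow_four (lam : ℝ) (Ω₀ : Set (EuclideanSpace ℝ (Fin N))) {τ : ℝ} (hτ : 0 < τ)
    (x : EuclideanSpace ℝ (Fin N)) :
    solution lam Ω₀ x (τ ^ 4) = ∫ z : EuclideanSpace ℝ (Fin N),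
      quarticKernel (lam * τ ^ 2) z * Ω₀.indicator (fun _ => (1 : ℝ)) (x - τ • z) := by
  set f : EuclideanSpace ℝ (Fin N) → ℝ := fun w =>
    quarticKernel (lam * τ ^ 2) (τ⁻¹ • w) * Ω₀.indicator (fun _ => (1 : ℝ)) (x - w) with hf
  have h := Measure.integral_comp_smul volume f τ
  have e : (fun z : EuclideanSpace ℝ (Fin N) => quarticKernel (lam * τ ^ 2) z *
      Ω₀.indicator (fun _ => (1 : ℝ)) (x - τ • z)) = fun z => f (τ • z) := by
    ext z
    simp only [hf, inv_smul_smul₀ hτ.ne']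
  rw [e, h, ← integral_sub_left_eq_self f volume x, solution, finrank_euclideanSpace_fin,
    abs_of_pos (by positivity), smul_eq_mul, ← integral_const_mul]
  congr 1
  ext y
  simp only [hf, sub_sub_cancel]
  rw [fundamentalSolution_pow_four lam hτ, mul_assoc]

lemma scaledSolution_pow_four (lam : ℝ) (Ω₀ : Set (EuclideanSpace ℝ (Fin N))) {b τ : ℝ}
    (hb : 0 < b) (hτ : 0 < τ) (x : EuclideanSpace ℝ (Fin N)) :
    scaledSolution lam Ω₀ b x (τ ^ 4) = ∫ z : EuclideanSpace ℝ (Fin N),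
      quarticKernel (lam * (b * τ) ^ 2) z *
        Ω₀.indicator (fun _ => (1 : ℝ)) (x - τ • (b • z)) := by
  rw [scaledSolution, ← mul_pow, solution_pow_four lam Ω₀ (by positivity)]
  simp only [smul_smul, mul_comm b τ]

lemma continuous_scaledSolution {lam : ℝ} {Ω₀ : Set (EuclideanSpace ℝ (Fin N))}
    (hΩ : IsCompact Ω₀) {b τ : ℝ} (hb : 0 < b) (hτ : 0 < τ) (h : |lam * (b * τ) ^ 2| ≤ 1) :
    Continuous fun x => scaledSolution lam Ω₀ b x (τ ^ 4) := by
  have hbτ : 0 < b * τ := by positivity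
  obtain ⟨C, hC0, hC⟩ := exists_abs_quarticKernel_le (EuclideanSpace ℝ (Fin N)) 0
  have hk := continuous_quarticKernel (E := EuclideanSpace ℝ (Fin N)) h
  have hi : Integrable (Ω₀.indicator fun _ => (1 : ℝ)) :=
    (integrable_indicator_iff hΩ.measurableSet).2
      (integrableOn_const hΩ.measure_lt_top.ne)
  simp only [scaledSolution, ← mul_pow, solution, fundamentalSolution_pow_four lam hbτ]
  refine continuous_of_dominated
    (bound := fun y => ((b * τ) ^ N)⁻¹ * C * Ω₀.indicator (fun _ => (1 : ℝ)) y)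
    (fun x => ?_) (fun x => .of_forall fun y => ?_) (hi.const_mul _) (.of_forall fun y => ?_)
  · exact AEStronglyMeasurable.mul (Continuous.aestronglyMeasurable (by fun_prop))
      hi.aestronglyMeasurable
  · rw [norm_mul, norm_mul, Real.norm_eq_abs, Real.norm_eq_abs, Real.norm_eq_abs,
      abs_of_pos (by positivity : 0 < ((b * τ) ^ N)⁻¹),
      abs_of_nonneg (Set.indicator_nonneg (fun _ _ => zero_le_one) y)]
    have h1 := hC _ h ((b * τ)⁻¹ • (x - y))
    simp only [Nat.cast_zero, neg_zero, Real.rpow_zero, mul_one] at h1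
    have h2 : 0 ≤ Ω₀.indicator (fun _ => (1 : ℝ)) y :=
      Set.indicator_nonneg (fun _ _ => zero_le_one) y
    gcongr
  · fun_prop

lemma continuous_thresholdFunction {lam : ℝ} {Ω₀ : Set (EuclideanSpace ℝ (Fin N))}
    (hΩ : IsCompact Ω₀) {a τ : ℝ} (ha : 0 < a) (hτ : 0 < τ)
    (h : |lam * (3 * a * τ) ^ 2| ≤ 1) :
    Continuous fun x => thresholdFunction lam Ω₀ a x (τ ^ 4) := by
  have hmono : ∀ b : ℝ, 0 < b → b ≤ 3 * a → |lam * (b * τ) ^ 2| ≤ 1 := by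
    intro b hb hba
    refine le_trans ?_ h
    rw [abs_mul, abs_mul, abs_of_nonneg (sq_nonneg (b * τ)), abs_of_nonneg (sq_nonneg (3 * a * τ))]
    gcongr
  unfold thresholdFunction
  exact ((continuous_scaledSolution hΩ (by positivity) hτ (hmono _ (by positivity) le_rfl)).sub
    ((continuous_scaledSolution hΩ (by positivity) hτ
      (hmono (2 * a) (by positivity) (by linarith))).const_mul 3)).add
    ((continuous_scaledSolution hΩ ha hτ (hmono a ha (by linarith))).const_mul 3)

/-! ### Limits along blow-up sequences -/

lemma tendsto_scaledSolution {lam : ℝ} {Ω₀ : Set (EuclideanSpace ℝ (Fin N))}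
    (hΩ : MeasurableSet Ω₀) {b : ℝ} (hb : 0 < b) {x : ℕ → EuclideanSpace ℝ (Fin N)} {τ : ℕ → ℝ}
    (hτ : ∀ k, 0 < τ k) (hτ0 : Tendsto τ atTop (𝓝 0)) {S : Set (EuclideanSpace ℝ (Fin N))}
    (h : ∀ᵐ z : EuclideanSpace ℝ (Fin N), ∀ᶠ k in atTop, x k - τ k • (b • z) ∈ Ω₀ ↔ z ∈ S) :
    Tendsto (fun k => scaledSolution lam Ω₀ b (x k) (τ k ^ 4)) atTop
      (𝓝 (∫ z : EuclideanSpace ℝ (Fin N),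
        quarticKernel 0 z * S.indicator (fun _ => (1 : ℝ)) z)) := by
  simp only [scaledSolution_pow_four lam Ω₀ hb (hτ _)]
  refine tendsto_integral_quarticKernel_mul ?_ (fun k => ?_) (fun k z => ?_) ?_
  · have := ((hτ0.const_mul b).pow 2).const_mul lam
    simpa using this
  · have hm : Measurable (Ω₀.indicator fun _ => (1 : ℝ)) := measurable_const.indicator hΩ
    exact (hm.comp (by fun_prop :
      Measurable fun z : EuclideanSpace ℝ (Fin N) => x k - τ k • (b • z))).aestronglyMeasurable
  · by_cases hz : x k - τ k • (b • z) ∈ Ω₀ <;> simp [hz]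
  · filter_upwards [h] with z hz
    refine tendsto_const_nhds.congr' ?_
    filter_upwards [hz] with k hk
    by_cases hS : z ∈ S
    · simp [hS, hk.2 hS]
    · simp [hS, mt hk.1 hS]

/-- The possible blow-up limits of `Ω` along `x k - τ k • y`: the whole space, the empty set, or a
half-space whose boundary misses the origin. -/
def BlowsUp {E : Type*} [NormedAddCommGroup E] [InnerProductSpace ℝ E] (Ω : Set E) (x : ℕ → E)
    (τ : ℕ → ℝ) : Prop :=
  (∀ y, ∀ᶠ k in atTop, x k - τ k • y ∈ Ω) ∨ (∀ y, ∀ᶠ k in atTop, x k - τ k • y ∉ Ω) ∨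
    ∃ (n : E) (c : ℝ), ‖n‖ = 1 ∧ c ≠ 0 ∧
      ∀ y, (c < ⟪n, y⟫ → ∀ᶠ k in atTop, x k - τ k • y ∈ Ω) ∧
        (⟪n, y⟫ < c → ∀ᶠ k in atTop, x k - τ k • y ∉ Ω)

lemma ae_inner_ne {E : Type*} [NormedAddCommGroup E] [InnerProductSpace ℝ E]
    [FiniteDimensional ℝ E] [MeasurableSpace E] [BorelSpace E] {n : E} (hn : ‖n‖ = 1) (c : ℝ) :
    ∀ᵐ z : E, ⟪n, z⟫ ≠ c := by
  have hnn : ⟪n, n⟫ = (1 : ℝ) := by rw [real_inner_self_eq_norm_sq, hn, one_pow]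
  set A := AffineSubspace.mk' (c • n) (ℝ ∙ n)ᗮ with hA
  have hmem : ∀ z : E, z ∈ A ↔ ⟪n, z⟫ = c := by
    intro z
    rw [hA, AffineSubspace.mem_mk', Submodule.mem_orthogonal_singleton_iff_inner_right, vsub_eq_sub,
      inner_sub_right, inner_smul_right, hnn, mul_one, sub_eq_zero]
  have hne : A ≠ ⊤ := by
    intro h
    have h1 : (c + 1) • n ∈ A := by rw [h]; trivial
    rw [hmem, inner_smul_right, hnn] at h1
    linarith
  have h0 := Measure.addHaar_affineSubspace volume A hne
  rw [ae_iff]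
  refine measure_mono_null (fun z hz => ?_) h0
  exact (hmem z).2 (not_not.1 hz)

/-- Along a blow-up sequence the threshold function stays away from `1 / 2`. -/
lemma BlowsUp.exists_tendsto_thresholdFunction {lam a : ℝ} (ha : 0 < a)
    {Ω₀ : Set (EuclideanSpace ℝ (Fin N))} (hΩ : MeasurableSet Ω₀)
    {x : ℕ → EuclideanSpace ℝ (Fin N)} {τ : ℕ → ℝ} (hτ : ∀ k, 0 < τ k)
    (hτ0 : Tendsto τ atTop (𝓝 0)) (h : BlowsUp Ω₀ x τ) :
    ∃ l : ℝ, l ≠ 1 / 2 ∧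
      Tendsto (fun k => thresholdFunction lam Ω₀ a (x k) (τ k ^ 4)) atTop (𝓝 l) := by
  have key : ∀ (S : ℝ → Set (EuclideanSpace ℝ (Fin N))),
      (∀ b > 0, ∀ᵐ z : EuclideanSpace ℝ (Fin N), ∀ᶠ k in atTop,
        x k - τ k • (b • z) ∈ Ω₀ ↔ z ∈ S b) →
      Tendsto (fun k => thresholdFunction lam Ω₀ a (x k) (τ k ^ 4)) atTop
        (𝓝 ((∫ z, quarticKernel 0 z * (S (3 * a)).indicator (fun _ => (1 : ℝ)) z) -
          3 * (∫ z, quarticKernel 0 z * (S (2 * a)).indicator (fun _ => (1 : ℝ)) z) +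
          3 * ∫ z, quarticKernel 0 z * (S a).indicator (fun _ => (1 : ℝ)) z)) := fun S hS =>
    ((tendsto_scaledSolution hΩ (by positivity) hτ hτ0 (hS (3 * a) (by positivity))).sub
      ((tendsto_scaledSolution hΩ (by positivity) hτ hτ0
        (hS (2 * a) (by positivity))).const_mul 3)).add
      ((tendsto_scaledSolution hΩ ha hτ hτ0 (hS a ha)).const_mul 3)
  rcases h with h | h | ⟨n, c, hn, hc, h⟩
  · have h1 := key (fun _ => Set.univ) fun b _ => .of_forall fun z => by
      filter_upwards [h (b • z)] with k hk
      simp [hk]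
    simp only [Set.indicator_univ, mul_one, integral_quarticKernel (B := 0) (by simp)] at h1
    exact ⟨_, by norm_num, h1⟩
  · have h1 := key (fun _ => ∅) fun b _ => .of_forall fun z => by
      filter_upwards [h (b • z)] with k hk
      simp [hk]
    simp only [Set.indicator_empty, mul_zero, integral_zero] at h1
    exact ⟨_, by norm_num, h1⟩
  · have h1 := key (fun b => {z | c / b < ⟪n, z⟫}) fun b hb => by
      filter_upwards [ae_inner_ne hn (c / b)] with z hz
      have h2 : ⟪n, b • z⟫ = ⟪n, z⟫ * b := by rw [inner_smul_right, mul_comm]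
      rcases lt_or_gt_of_ne hz with h3 | h3
      · filter_upwards [(h (b • z)).2 (by rw [h2]; exact (lt_div_iff₀ hb).1 h3)] with k hk
        simp [hk, h3.le]
      · filter_upwards [(h (b • z)).1 (by rw [h2]; exact (div_lt_iff₀ hb).1 h3)] with k hk
        simpa [hk] using h3
    simp only [integral_quarticKernel_mul_indicator_halfSpace hn] at h1
    refine ⟨_, ?_, h1⟩
    have h2 := thresholdProfile_ne_zero (div_ne_zero hc ha.ne')
    intro h3
    apply h2
    rw [thresholdProfile, div_div, div_div, mul_comm a 3, mul_comm a 2]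
    linarith

end Solution

/-! ### Blow-up of a set with smooth boundary -/

section Geometry

lemma mem_of_disjoint_frontier {E : Type*} [TopologicalSpace E] {s Ω : Set E}
    (hs : IsPreconnected s) (hd : Disjoint s (frontier Ω)) {x y : E} (hx : x ∈ s) (hy : y ∈ s)
    (hxΩ : x ∈ Ω) : y ∈ Ω := by
  have hint : ∀ z ∈ s, z ∈ closure Ω → z ∈ interior Ω := fun z hz hzc => by
    by_contra hzi
    exact Set.disjoint_left.1 hd hz ⟨hzc, hzi⟩
  have h := hs.subset_left_of_subset_union isOpen_interior isClosed_closure.isOpen_compl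
    (Set.disjoint_compl_right_iff_subset.2 interior_subset_closure)
    (fun z hz => by
      by_cases hzc : z ∈ closure Ω
      · exact Or.inl (hint z hz hzc)
      · exact Or.inr hzc) ⟨x, hx, hint x hx (subset_closure hxΩ)⟩
  exact interior_subset (h hy)

variable {E : Type*} [NormedAddCommGroup E] [InnerProductSpace ℝ E]

/-- A ball of radius `δ` around a point of `Ω` that misses the frontier lies in `Ω`, and it contains
the blow-up points eventually. -/
lemma eventually_mem_of_le_infDist {Ω : Set E} {x : ℕ → E} {τ : ℕ → ℝ}
    (hτ0 : Tendsto τ atTop (𝓝 0)) {δ : ℝ} (hδ : 0 < δ)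
    (hd : ∀ k, δ ≤ Metric.infDist (x k) (frontier Ω)) (hx : ∀ k, x k ∈ Ω) (y : E) :
    ∀ᶠ k in atTop, x k - τ k • y ∈ Ω := by
  have h : Tendsto (fun k => ‖τ k • y‖) atTop (𝓝 0) := by
    simpa using (hτ0.smul_const y).norm
  filter_upwards [h.eventually_lt_const hδ] with k hk
  refine mem_of_disjoint_frontier (convex_ball (x k) δ).isPreconnected
    (Set.disjoint_left.2 fun z hz hzf => ?_) (Metric.mem_ball_self hδ) ?_ (hx k)
  · have h1 := Metric.infDist_le_dist_of_mem (x := x k) hzf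
    rw [Metric.mem_ball, dist_comm] at hz
    linarith [hd k]
  · simpa [Metric.mem_ball, dist_eq_norm] using hk

lemma exists_blowsUp_of_le_infDist {Ω : Set E} {x : ℕ → E} {τ : ℕ → ℝ}
    (hτ0 : Tendsto τ atTop (𝓝 0)) {δ : ℝ} (hδ : 0 < δ)
    (hd : ∃ᶠ k in atTop, δ ≤ Metric.infDist (x k) (frontier Ω)) :
    ∃ φ : ℕ → ℕ, StrictMono φ ∧ BlowsUp Ω (x ∘ φ) (τ ∘ φ) := by
  have h : (∃ᶠ k in atTop, δ ≤ Metric.infDist (x k) (frontier Ω) ∧ x k ∈ Ω) ∨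
      ∃ᶠ k in atTop, δ ≤ Metric.infDist (x k) (frontier Ω) ∧ x k ∉ Ω := by
    rw [← frequently_or_distrib]
    refine hd.mono fun k hk => ?_
    by_cases hx : x k ∈ Ω
    · exact Or.inl ⟨hk, hx⟩
    · exact Or.inr ⟨hk, hx⟩
  rcases h with h | h
  · obtain ⟨φ, hφ, hk⟩ := extraction_of_frequently_atTop h
    exact ⟨φ, hφ, Or.inl (eventually_mem_of_le_infDist (hτ0.comp hφ.tendsto_atTop) hδ
      (fun k => (hk k).1) fun k => (hk k).2)⟩
  · obtain ⟨φ, hφ, hk⟩ := extraction_of_frequently_atTop h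
    refine ⟨φ, hφ, Or.inr (Or.inl (eventually_mem_of_le_infDist (Ω := Ωᶜ)
      (hτ0.comp hφ.tendsto_atTop) hδ (fun k => ?_) fun k => (hk k).2))⟩
    rw [frontier_compl]
    exact (hk k).1

/-- If `Ω` is near `p` the region on and below a graph, then the points of the graph are frontier
points of `Ω`: they belong to `Ω`, and moving up along `n` leaves it. -/
lemma mem_frontier_of_graph {Ω : Set E} {p n q : E} {f : (ℝ ∙ n)ᗮ → ℝ} {r : ℝ} (hn : ‖n‖ = 1)
    (hΩ : ∀ y ∈ Metric.ball p r,
      (y ∈ Ω ↔ ⟪n, y - p⟫ ≤ f ((ℝ ∙ n)ᗮ.orthogonalProjectionOnto (y - p))))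
    (hq : q ∈ Metric.ball p r)
    (hqf : ⟪n, q - p⟫ = f ((ℝ ∙ n)ᗮ.orthogonalProjectionOnto (q - p))) :
    q ∈ frontier Ω := by
  have hnn : ⟪n, n⟫ = (1 : ℝ) := by rw [real_inner_self_eq_norm_sq, hn, one_pow]
  have hproj : (ℝ ∙ n)ᗮ.orthogonalProjectionOnto n = 0 := by
    apply Submodule.orthogonalProjectionOnto_orthogonal_apply_eq_zero
    exact Submodule.mem_span_singleton_self n
  rw [frontier_eq_closure_inter_closure]
  refine ⟨subset_closure ((hΩ q hq).2 hqf.le), ?_⟩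
  have ht : Tendsto (fun s : ℝ => q + s • n) (𝓝[>] 0) (𝓝 q) := by
    have : Continuous fun s : ℝ => q + s • n := by fun_prop
    simpa using (this.tendsto 0).mono_left nhdsWithin_le_nhds
  refine mem_closure_of_tendsto ht ?_
  filter_upwards [ht.eventually (Metric.isOpen_ball.mem_nhds hq), self_mem_nhdsWithin] with s hs hs0
  intro h
  rw [hΩ _ hs, add_sub_right_comm, inner_add_right, inner_smul_right, hnn, map_add, map_smul,
    hproj, smul_zero, add_zero, hqf] at h
  linarith [Set.mem_Ioi.1 hs0]

/-- In a graph chart at `p`, the blow-up at points `x k → p` is governed by the rescaled heights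
`c k` of `x k` over the graph, and the graph flattens as its gradient vanishes at `p`. -/
lemma exists_blowsUp_of_tendsto {Ω : Set E} {p n : E} {f : (ℝ ∙ n)ᗮ → ℝ} {r : ℝ}
    (hn : ‖n‖ = 1) (hr : 0 < r) (hf : HasStrictFDerivAt f (0 : (ℝ ∙ n)ᗮ →L[ℝ] ℝ) 0) (hf0 : f 0 = 0)
    (hΩ : ∀ y ∈ Metric.ball p r,
      (y ∈ Ω ↔ ⟪n, y - p⟫ ≤ f ((ℝ ∙ n)ᗮ.orthogonalProjectionOnto (y - p))))
    {x : ℕ → E} {τ : ℕ → ℝ} (hx : Tendsto x atTop (𝓝 p)) (hτ : ∀ k, 0 < τ k)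
    (hτ0 : Tendsto τ atTop (𝓝 0)) {ε : ℝ} (hε : 0 < ε)
    (hd : ∀ k, ε * τ k < Metric.infDist (x k) (frontier Ω)) :
    ∃ φ : ℕ → ℕ, StrictMono φ ∧ BlowsUp Ω (x ∘ φ) (τ ∘ φ) := by
  have hnn : ⟪n, n⟫ = (1 : ℝ) := by rw [real_inner_self_eq_norm_sq, hn, one_pow]
  set P := (ℝ ∙ n)ᗮ.orthogonalProjectionOnto with hP
  have hproj : P n = 0 := by
    apply Submodule.orthogonalProjectionOnto_orthogonal_apply_eq_zero
    exact Submodule.mem_span_singleton_self n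
  have hxp : Tendsto (fun k => x k - p) atTop (𝓝 0) := by simpa using hx.sub_const p
  have hz : Tendsto (fun k => P (x k - p)) atTop (𝓝 0) := by
    simpa [Function.comp_def, -map_sub] using (P.continuous.tendsto 0).comp hxp
  have hfz : Tendsto (fun k => f (P (x k - p))) atTop (𝓝 0) := by
    simpa [Function.comp_def, hf0, -map_sub] using hf.continuousAt.tendsto.comp hz
  have hh : Tendsto (fun k => ⟪n, x k - p⟫ - f (P (x k - p))) atTop (𝓝 0) := by
    have : Continuous fun y : E => (⟪n, y⟫ : ℝ) := by fun_prop
    simpa using ((this.tendsto 0).comp hxp).sub hfz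
  set c : ℕ → ℝ := fun k => (⟪n, x k - p⟫ - f (P (x k - p))) / τ k with hc
  have hcτ : ∀ k, c k * τ k = ⟪n, x k - p⟫ - f (P (x k - p)) := fun k =>
    div_mul_cancel₀ _ (hτ k).ne'
  -- The vertical projection of `x k` to the graph lies on the frontier, at distance `|c k| τ k`.
  have hcε : ∀ᶠ k in atTop, ε < |c k| := by
    have hq : Tendsto (fun k => x k - (c k * τ k) • n) atTop (𝓝 p) := by
      simp only [hcτ]
      simpa using hx.sub (hh.smul_const n)
    filter_upwards [hq.eventually (Metric.ball_mem_nhds p hr)] with k hk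
    have h1 : x k - (c k * τ k) • n ∈ frontier Ω := by
      refine mem_frontier_of_graph hn hΩ hk ?_
      rw [sub_right_comm, inner_sub_right, inner_smul_right, hnn, map_sub, map_smul, ← hP, hproj,
        smul_zero, sub_zero, hcτ]
      ring
    have h2 := (hd k).trans_le (Metric.infDist_le_dist_of_mem h1)
    rw [dist_eq_norm, sub_sub_cancel, norm_smul, hn, mul_one, norm_mul, Real.norm_eq_abs,
      Real.norm_eq_abs, abs_of_pos (hτ k)] at h2
    exact lt_of_mul_lt_mul_right h2 (hτ k).le
  set e : E → ℕ → ℝ := fun y k => (f (P (x k - p) - τ k • P y) - f (P (x k - p))) / τ k with he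
  have he0 : ∀ y, Tendsto (e y) atTop (𝓝 0) := by
    intro y
    have h1 : Tendsto (fun k => (P (x k - p) - τ k • P y, P (x k - p))) atTop
        (𝓝 ((0 : (ℝ ∙ n)ᗮ), (0 : (ℝ ∙ n)ᗮ))) := by
      refine Tendsto.prodMk_nhds ?_ hz
      simpa using hz.sub (hτ0.smul_const (P y))
    have h2 := hf.isLittleO.comp_tendsto h1
    have h3 : (fun k => f (P (x k - p) - τ k • P y) - f (P (x k - p))) =o[atTop] τ := by
      refine (h2.congr_left fun k => by simp).trans_isBigO ?_
      refine Asymptotics.IsBigO.of_bound ‖P y‖ (.of_forall fun k => ?_)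
      simp only [Function.comp, sub_sub_cancel_left, norm_neg, norm_smul]
      rw [mul_comm]
    exact h3.tendsto_div_nhds_zero
  have hiff : ∀ y, ∀ᶠ k in atTop, x k - τ k • y ∈ Ω ↔ c k - e y k ≤ ⟪n, y⟫ := by
    intro y
    have h1 : Tendsto (fun k => x k - τ k • y) atTop (𝓝 p) := by
      simpa using hx.sub (hτ0.smul_const y)
    filter_upwards [h1.eventually (Metric.ball_mem_nhds p hr)] with k hk
    rw [hΩ _ hk, sub_right_comm, inner_sub_right, inner_smul_right, map_sub, map_smul, hc, he]
    simp only
    rw [← sub_div, div_le_iff₀ (hτ k)]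
    constructor <;> intro h <;> linarith
  obtain ⟨l, -, φ, hφ, hl⟩ := isCompact_univ.tendsto_subseq (x := fun k => (c k : EReal))
    fun _ => Set.mem_univ _
  have hφt := hφ.tendsto_atTop
  refine ⟨φ, hφ, ?_⟩
  induction l with
  | bot =>
    left
    intro y
    have h1 : Tendsto (c ∘ φ) atTop atBot := EReal.tendsto_coe_nhds_bot_iff.1 hl
    filter_upwards [hφt.eventually (hiff y), h1.eventually_le_atBot (⟪n, y⟫ - 1),
      hφt.eventually ((he0 y).eventually_const_lt (show (-1 : ℝ) < 0 by norm_num))] with k h2 h3 h4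
    simp only [Function.comp] at h3 ⊢
    exact h2.2 (by linarith)
  | top =>
    right; left
    intro y
    have h1 : Tendsto (c ∘ φ) atTop atTop := EReal.tendsto_coe_nhds_top_iff.1 hl
    filter_upwards [hφt.eventually (hiff y), h1.eventually_ge_atTop (⟪n, y⟫ + 1),
      hφt.eventually ((he0 y).eventually_lt_const (show (0 : ℝ) < 1 by norm_num))] with k h2 h3 h4
    simp only [Function.comp] at h3 ⊢
    rw [h2]
    linarith
  | coe l =>
    right; right
    have h1 : Tendsto (c ∘ φ) atTop (𝓝 l) := EReal.tendsto_coe.1 hl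
    refine ⟨n, l, hn, ?_, fun y => ?_⟩
    · have h2 : ε ≤ |l| := ge_of_tendsto h1.abs ((hφt.eventually hcε).mono fun k hk => hk.le)
      exact abs_pos.1 (hε.trans_le h2)
    · have h2 : Tendsto (fun k => c (φ k) - e y (φ k)) atTop (𝓝 l) := by
        simpa using h1.sub ((he0 y).comp hφt)
      refine ⟨fun h => ?_, fun h => ?_⟩
      · filter_upwards [hφt.eventually (hiff y), h2.eventually_lt_const h] with k h3 h4
        exact h3.2 h4.le
      · filter_upwards [hφt.eventually (hiff y), h2.eventually_const_lt h] with k h3 h4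
        simp only [Function.comp]
        rw [h3]
        exact not_le.2 h4

/-- Points far from the frontier have a ball inside or outside of `Ω`; points approaching the
frontier accumulate at one of its points by compactness, and its chart applies. -/
lemma exists_blowsUp {N j : ℕ} (hj : 1 ≤ j) {Ω : Set (EuclideanSpace ℝ (Fin N))}
    (hΩ : IsCompact Ω) (hb : HasBoundaryOfClass j Ω) {x : ℕ → EuclideanSpace ℝ (Fin N)}
    {τ : ℕ → ℝ} (hτ : ∀ k, 0 < τ k) (hτ0 : Tendsto τ atTop (𝓝 0)) {ε : ℝ} (hε : 0 < ε)
    (hd : ∀ k, ε * τ k < Metric.infDist (x k) (frontier Ω)) :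
    ∃ φ : ℕ → ℕ, StrictMono φ ∧ BlowsUp Ω (x ∘ φ) (τ ∘ φ) := by
  by_cases h : Tendsto (fun k => Metric.infDist (x k) (frontier Ω)) atTop (𝓝 0)
  · have hcpt : IsCompact (frontier Ω) :=
      hΩ.of_isClosed_subset isClosed_frontier
        (frontier_subset_closure.trans_eq hΩ.isClosed.closure_eq)
    have hne : (frontier Ω).Nonempty := by
      -- For an empty frontier `Metric.infDist` has the value `0`, against `hd`.
      by_contra h0
      have h1 := hd 0
      rw [Set.not_nonempty_iff_eq_empty.1 h0, Metric.infDist_empty] at h1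
      exact absurd h1 (not_lt.2 (mul_pos hε (hτ 0)).le)
    choose q hq hqd using fun k => hcpt.exists_infDist_eq_dist hne (x k)
    obtain ⟨p, hp, φ, hφ, hl⟩ := hcpt.tendsto_subseq hq
    have hφt := hφ.tendsto_atTop
    obtain ⟨n, hn, f, hf, hf0, hf', r, hr, hΩr⟩ := hb p hp
    have hx : Tendsto (x ∘ φ) atTop (𝓝 p) := by
      refine (tendsto_iff_of_dist ?_).2 hl
      simp only [hqd] at h
      exact h.comp hφt
    have hstrict := (hf.contDiffAt (x := 0)).hasStrictFDerivAt (by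
      simp only [ne_eq, Nat.cast_eq_zero, WithTop.coe_eq_zero]
      omega)
    rw [hf'] at hstrict
    obtain ⟨ψ, hψ, hB⟩ := exists_blowsUp_of_tendsto hn hr hstrict hf0 hΩr hx (fun k => hτ (φ k))
      (hτ0.comp hφt) hε fun k => hd (φ k)
    exact ⟨φ ∘ ψ, hφ.comp hψ, hB⟩
  · rw [Metric.tendsto_atTop] at h
    push Not at h
    obtain ⟨δ, hδ, h⟩ := h
    refine exists_blowsUp_of_le_infDist hτ0 hδ (frequently_atTop.2 fun K => ?_)
    obtain ⟨k, hk, hk'⟩ := h K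
    refine ⟨k, hk, ?_⟩
    rwa [Real.dist_eq, sub_zero, abs_of_nonneg Metric.infDist_nonneg] at hk'

end Geometry

lemma abs_signedDistance {N : ℕ} (Ω₀ : Set (EuclideanSpace ℝ (Fin N)))
    (y : EuclideanSpace ℝ (Fin N)) :
    |signedDistance Ω₀ y| = Metric.infDist y (frontier Ω₀) := by
  unfold signedDistance
  split_ifs
  · exact abs_of_nonneg Metric.infDist_nonneg
  · rw [abs_neg, abs_of_nonneg Metric.infDist_nonneg]

end Thresholding

open Filter Topology Thresholding in
theorem proposition4p2 (N : ℕ) (hN : 2 ≤ N) (lam : ℝ) (a : ℝ) (ha : 0 < a)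
    (ha4 : 18 * a ^ 4 / 11 = 1) (Ω₀ : Set (EuclideanSpace ℝ (Fin N)))
    (hcompact : IsCompact Ω₀) (hboundary : Thresholding.HasBoundaryOfClass 5 Ω₀)
    (ε : ℝ) (hε : ε ∈ Set.Ioo (0 : ℝ) 1) :
    ∃ tε : ℝ, 0 < tε ∧ ∀ t ∈ Set.Ioo (0 : ℝ) tε,
      frontier (Thresholding.evolvedSet lam Ω₀ a t) ⊆
        {x | |Thresholding.signedDistance Ω₀ x| ≤ ε * t ^ (1 / 4 : ℝ)} := by
  by_contra hcon
  push Not at hcon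
  choose t ht hsub using fun k : ℕ => hcon (1 / ((k : ℝ) + 1)) (by positivity)
  simp only [Set.not_subset, Set.mem_ofPred_eq, not_le, abs_signedDistance] at hsub
  choose x hx hdist using hsub
  set τ : ℕ → ℝ := fun k => t k ^ (1 / 4 : ℝ) with hτdef
  have hτ : ∀ k, 0 < τ k := fun k => Real.rpow_pos_of_pos (ht k).1 _
  have hτ4 : ∀ k, τ k ^ 4 = t k := fun k => by
    rw [hτdef, ← Real.rpow_natCast, ← Real.rpow_mul (ht k).1.le]
    norm_num
  have ht0 : Tendsto t atTop (𝓝 0) :=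
    squeeze_zero (fun k => (ht k).1.le) (fun k => (ht k).2.le)
      tendsto_one_div_add_atTop_nhds_zero_nat
  have hτ0 : Tendsto τ atTop (𝓝 0) := by
    have h := ht0.rpow_const (p := (1 / 4 : ℝ)) (Or.inr (by norm_num))
    rwa [Real.zero_rpow (by norm_num)] at h
  obtain ⟨φ, hφ, hB⟩ := exists_blowsUp (j := 5) (by norm_num) hcompact hboundary hτ hτ0 hε.1 hdist
  obtain ⟨l, hl, hlim⟩ := hB.exists_tendsto_thresholdFunction (lam := lam) ha
    hcompact.measurableSet (fun k => hτ (φ k)) (hτ0.comp hφ.tendsto_atTop)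
  have hsmall : ∀ᶠ k in atTop, |lam * (3 * a * τ k) ^ 2| < 1 := by
    have h := (((hτ0.const_mul (3 * a)).pow 2).const_mul lam).abs
    refine h.eventually_lt_const ?_
    norm_num
  refine hl (tendsto_nhds_unique hlim (tendsto_const_nhds.congr' ?_))
  filter_upwards [hφ.tendsto_atTop.eventually hsmall] with k hk
  have h := hx (φ k)
  rw [evolvedSet, ← hτ4] at h
  exact frontier_le_subset_eq continuous_const
    (continuous_thresholdFunction hcompact ha (hτ _) hk.le) h
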